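/- **Model.** There are $d\ge 1$ buyer types, an unknown distribution $\mathcal P$ on $[d]=\{1,\dots,d\}$ with $q_i=\Pr_{j\sim\mathcal P}[j=i]$ and $q_{\min}=\min_i q_i$, and for each type $i$ an unknown distribution $\mathcal D_i$ on $[0,1]$ with mean $\theta_i$, where $\theta_1\le\dots\le\theta_d$ are known to the seller. An item is sold over $T\ge 1$ rounds. In round $t$ the seller, having seen the reviews $\sigma_{t-1}$ and purchases of the earlier rounds, posts a price $p_t\in[0,1]$. A buyer arrives with type $i_t\sim\mathcal P$ and value $v_t\sim\mathcal D_{i_t}$ (independently over rounds), and buys ($b_t=1$) iff $p_t\le\tau_t(\sigma_{t-1},i_t)$, for a threshold function $\tau_t$; a buyer who buys leaves the review $(i_t,v_t)$, which is added to $\sigma_{t-1}$ to form $\sigma_t$; otherwise $b_t=0$ and $\sigma_t=\sigma_{t-1}$. For a type $i$ let $\Phi_{i,t}$ be the multiset of values reported in $\sigma_{t-1}$ by buyers of type $i$, and for $m\ge 1$ let $$\mathrm{LB}^{(m)}_{i,t}=\max\Bigl\{0,\ \tfrac{1}{|\Phi_{i,t}|}\sum_{v\in\Phi_{i,t}}v-\sqrt{\tfrac{1}{2|\Phi_{i,t}|}\ln\tfrac{m}{\eta}}\Bigr\}$$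 if $\Phi_{i,t}\neq\emptyset$, and $\mathrm{LB}^{(m)}_{i,t}=0$ otherwise. The buyers are $\eta$-pessimistic, $0<\eta\le 1$, if $\tau_t(\sigma_{t-1},i)\ge \mathrm{LB}^{(t)}_{i,t}$ for every round $t\in[T]$, every type $i$ and all possible reviews $\sigma_{t-1}$. The expected regret is $$\mathbb E[R_T]=T\max_{p\in[0,1]}p\Pr_{i\sim\mathcal P}[\theta_i\ge p]-\mathbb E\Bigl[\sum_{t=1}^T p_tb_t\Bigr].$$ **Algorithm with parameter $\lambda$.** Let $t_\lambda=\lfloor 32\ln(dT^2)/\lambda+1\rfloor$. In rounds $t\le t_\lambda$ set $p_t=0$. Let $\overline q_i$ be the fraction of these rounds in which $i_t=i$, and $S_{t_\lambda+1}=Q=\{i:\overline q_i\ge 3\lambda/4\}$. In each round $t>t_\lambda$ set $p_t=\min_{i\in S_t}\min\{\theta_i,\mathrm{LB}^{(T)}_{i,t}\}$. After the round let $\rho_t=\sqrt{\ln(dT^2)/(2(t-t_\lambda))}$ and, for $i\in S_t$, $$\overline\mu_{i,t}=\frac1{t-t_\lambda}\sum_{s=t_\lambda+1}^t\theta_i\,\mathbb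 I(b_s=1,\ \theta_{i_s}\ge\theta_i,\ i_s\in Q),$$ let $i_0=\min\{i\in S_t:\overline\mu_{i,t}+\rho_t\ge\max_{k\in S_t}(\overline\mu_{k,t}-\rho_t)\}$, and set $S_{t+1}=S_t\cap\{i_0,\dots,d\}$. **Statement.** There is a universal constant $C$ such that for all such instances with $\eta$-pessimistic buyers, the algorithm with $\lambda=d^{-2/3}T^{-1/3}$ satisfies the following. If $q_{\min}\le 2d^{-2/3}T^{-1/3}$, then $$\mathbb E[R_T]\le C\Bigl(T^{2/3}d^{1/3}+T^{2/3}d^{1/3}\sqrt{\ln\tfrac{dT}{\eta}}+\sqrt{T\ln(dT)}+T^{1/3}d^{2/3}\ln(dT)\Bigr),$$ and if $q_{\min}>2d^{-2/3}T^{-1/3}$, then $$\mathbb E[R_T]\le C\Bigl(\sqrt{\tfrac{T}{q_{\min}}\ln\tfrac{dT}{\eta}}+T^{1/3}d^{2/3}\ln(dT)\Bigr).$$ -/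

import Mathlib

open MeasureTheory ProbabilityTheory

noncomputable section

namespace ReviewPricing

/-- A review: the type of the buyer who left it and the reported ex-post value in `[0, 1]`. -/
abbrev Review (d : ℕ) : Type := Fin d × unitInterval

/-- What the seller observes in one round: the review, if the buyer purchased, and
`none` if the buyer did not purchase. -/
abbrev Obs (d : ℕ) : Type := Option (Review d)

/-- Purchasing thresholds `τ t σ i` of a buyer of type `i` who arrives in round `t = 1, 2, …` and
sees the past reviews `σ` (most recent first). The buyer purchases iff the price is at most
this threshold. -/
abbrev Thresholds (d : ℕ) : Type := ℕ → List (Review d) → Fin d → ℝ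

/-! ### Buyers -/

/-- The values in `σ` that were reported by buyers of type `i`. -/
def valuesOf {d : ℕ} (σ : List (Review d)) (i : Fin d) : List ℝ :=
  (σ.filter (fun r => r.1 = i)).map (fun r => (r.2 : ℝ))

/-- The lower confidence bound for type `i` computed from the reviews `σ`, with `log (m / η)` in
the confidence term. The buyer of round `t` uses `m = t`, the seller uses `m = T`. -/
def lowerConf {d : ℕ} (η : ℝ) (m : ℕ) (σ : List (Review d)) (i : Fin d) : ℝ :=
  if valuesOf σ i = [] then 0
  else max 0 ((valuesOf σ i).sum / (valuesOf σ i).length -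
    √(1 / (2 * (valuesOf σ i).length) * Real.log (m / η)))

/-- All buyers of the rounds `1, …, T` are `η`-pessimistic. Before round `t` there are fewer than
`t` reviews. -/
def Pessimistic {d : ℕ} (η : ℝ) (T : ℕ) (τ : Thresholds d) : Prop :=
  ∀ t, 1 ≤ t → t ≤ T → ∀ σ : List (Review d), σ.length < t → ∀ i, lowerConf η t σ i ≤ τ t σ i

/-- Each threshold is a measurable function of the past reviews. -/
def MeasurableThresholds {d : ℕ} (τ : Thresholds d) : Prop :=
  ∀ (t n : ℕ) (i : Fin d), Measurable fun x : Fin n → Review d => τ t (List.ofFn x) i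

/-! ### The interaction between a seller and the buyers -/

/-- A pricing algorithm sets the price from the observations in the past rounds (most recent
first). -/
abbrev Pricing (d : ℕ) : Type := List (Obs d) → ℝ

/-- The observations after `t` rounds, most recent first. Here `x t` is the type of the buyer of
round `t` with the ex-post value this buyer has in case of a purchase. -/
def history {d : ℕ} (τ : Thresholds d) (A : Pricing d) (x : ℕ → Review d) : ℕ → List (Obs d)
  | 0 => []
  | t + 1 =>
    (if A (history τ A x t) ≤ τ (t + 1) (history τ A x t).reduceOption (x (t + 1)).1
      then some (x (t + 1)) else none) :: history τ A x t

/-- The price in round `t ≥ 1`. -/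
def price {d : ℕ} (τ : Thresholds d) (A : Pricing d) (x : ℕ → Review d) (t : ℕ) : ℝ :=
  A (history τ A x (t - 1))

/-- The indicator of a purchase in round `t ≥ 1`. -/
def bought {d : ℕ} (τ : Thresholds d) (A : Pricing d) (x : ℕ → Review d) (t : ℕ) : ℝ :=
  if price τ A x t ≤ τ t (history τ A x (t - 1)).reduceOption (x t).1 then 1 else 0

/-- The law of one buyer: the type `i` has law `P`, and given `i` the value has law `D i`. -/
abbrev buyerLaw {d : ℕ} (P : PMF (Fin d)) (D : Kernel (Fin d) unitInterval) :
    Measure (Review d) :=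
  P.toMeasure ⊗ₘ D

/-- The maximum over `p ∈ [0, 1]` of `p * Pr_{i ∼ P} [θ i ≥ p]`. -/
def optimalRevenue {d : ℕ} (P : PMF (Fin d)) (θ : Fin d → ℝ) : ℝ :=
  ⨆ p : unitInterval, (p : ℝ) * P.toMeasure.real {i | (p : ℝ) ≤ θ i}

/-- The expected regret of `A` after `T` rounds; buyers of distinct rounds are independent. -/
def expectedRegret {d : ℕ} (T : ℕ) (P : PMF (Fin d)) (D : Kernel (Fin d) unitInterval)
    [IsMarkovKernel D] (θ : Fin d → ℝ) (τ : Thresholds d) (A : Pricing d) : ℝ :=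
  T * optimalRevenue P θ -
    ∫ x, ∑ t ∈ Finset.Icc 1 T, price τ A x t * bought τ A x t
      ∂(Measure.infinitePi fun _ : ℕ => buyerLaw P D)

/-- The smallest probability of a type. -/
def qmin {d : ℕ} (P : PMF (Fin d)) : ℝ := ⨅ i, (P i).toReal

/-! ### The pricing algorithm -/

/-- The number `t_λ` of rounds of the first phase. -/
def phaseOne (d T : ℕ) (lam : ℝ) : ℕ := ⌊32 * Real.log (d * (T : ℝ) ^ 2) / lam + 1⌋₊

/-- The observations of the first `n` rounds. -/
def firstRounds {d : ℕ} (n : ℕ) (h : List (Obs d)) : List (Obs d) := h.drop (h.length - n)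

/-- The observations of the rounds after round `n`. -/
def laterRounds {d : ℕ} (n : ℕ) (h : List (Obs d)) : List (Obs d) := h.take (h.length - n)

/-- The set `Q` of the types that were seen in at least a `3λ/4` fraction of the first `n`
rounds. -/
def commonTypes {d : ℕ} (lam : ℝ) (n : ℕ) (h : List (Obs d)) : Finset (Fin d) :=
  {i | 3 * lam / 4 ≤ ((firstRounds n h).reduceOption.countP (fun r => r.1 = i) : ℝ) / n}

/-- The estimate, after the rounds `h`, of the revenue of the price `θ i` on `Q`: the average over
the rounds `s > n` of `θ i` times the indicator that the buyer of round `s` purchased, has type in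
`Q`, and has ex-ante value at least `θ i`. -/
def revEstimate {d : ℕ} (θ : Fin d → ℝ) (lam : ℝ) (n : ℕ) (h : List (Obs d)) (i : Fin d) : ℝ :=
  θ i * ((laterRounds n h).reduceOption.countP
    (fun r => θ i ≤ θ r.1 ∧ r.1 ∈ commonTypes lam n h) : ℝ) / ((h.length : ℝ) - n)

/-- The confidence radius after the rounds `h`. -/
def radius {d : ℕ} (T n : ℕ) (h : List (Obs d)) : ℝ :=
  √(Real.log (d * (T : ℝ) ^ 2) / (2 * ((h.length : ℝ) - n)))

/-- The active types in `S` that may have optimal revenue: the upper confidence bound is at least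
every lower confidence bound. -/
def plausible {d : ℕ} (T : ℕ) (θ : Fin d → ℝ) (lam : ℝ) (n : ℕ) (h : List (Obs d))
    (S : Finset (Fin d)) : Finset (Fin d) :=
  {i ∈ S | ∀ k ∈ S, revEstimate θ lam n h k - radius T n h ≤ revEstimate θ lam n h i + radius T n h}

/-- The set of active types for the round after the rounds `h`, meaningful from the end of the
first phase on. At the end of the first phase it is `Q`; after each later round the types below the
smallest plausible active type are eliminated. -/
def activeTypes {d : ℕ} (T : ℕ) (θ : Fin d → ℝ) (lam : ℝ) (n : ℕ) :
    List (Obs d) → Finset (Fin d)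
  | [] => commonTypes lam n []
  | o :: h =>
    if (o :: h).length ≤ n then commonTypes lam n (o :: h)
    else {j ∈ activeTypes T θ lam n h |
      (plausible T θ lam n (o :: h) (activeTypes T θ lam n h)).min ≤ (j : WithTop (Fin d))}

/-- The lowest, over the active types `i ∈ S`, of `θ i` and the lower confidence bound of `i`.
The value for empty `S` is a convention. -/
def activePrice {d : ℕ} (T : ℕ) (η : ℝ) (θ : Fin d → ℝ) (σ : List (Review d))
    (S : Finset (Fin d)) : ℝ :=
  if hS : S.Nonempty then S.inf' hS (fun i => min (θ i) (lowerConf η T σ i)) else 0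

/-- The two-phase pricing algorithm with parameter `λ`. It knows `T`, `d`, `η` and `θ`, but neither
the law of the types nor the laws of the ex-post values. -/
def onlinePricing {d : ℕ} (T : ℕ) (η : ℝ) (θ : Fin d → ℝ) (lam : ℝ) : Pricing d := fun h =>
  if h.length < phaseOne d T lam then 0
  else activePrice T η θ h.reduceOption (activeTypes T θ lam (phaseOne d T lam) h)

end ReviewPricing

end

/-! The point of the algorithm is that an active type never refuses. The price is at most the bound
`LB^(T)` of every active type, and `LB^(T) ≤ LB^(t) ≤ τ_t` for pessimistic buyers, so a buyer of an
active type always purchases (`buys_of_mem_active`). Active sets only shrink, so a type that is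
still active has reviewed in every round in which it arrived. Two things follow.

The reviews of an active type are an unbiased sample with about `t q_i` entries, so its lower
confidence bound is close to `θ i` (`le_lowerConf_of_active`). Moreover the active set is closed
upwards in `Q` (`mem_activeAfter_of_le`), so the types counted in the estimate for an active `θ i`
are all active, and the estimate is an uncensored average of independent indicators
(`revEstimate_history_eq`), although the posted price differs from `θ i`. Hence successive
elimination works: the best type of `Q` survives, the smallest active type `m` is within four radii
of it, the price is close to `θ m`, and the active types, which are exactly those of `Q` above `m`,
pay it (`optimalRevenue_le_price_mul_mass`).

The free first phase makes `Q` contain every type of probability at least `λ` and none below `λ/2`;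
ignoring the remaining types costs at most their mass per round (`optimalRevenue_le`).

These statements are deterministic on a typical sequence of buyers; the others have probability at
most `6/T` (`not_typical_prob_le`). Independence enters twice: `Q` is determined by the first phase
and the estimates count later rounds (`bad_estimate_prob_le`), and the next buyer is independent of
the past (`integral_price_mul_active`). Summing the losses of order `t^(-1/2)` gives
`expectedRegret_le`, and the theorem is the choice of `λ`. -/

noncomputable section

namespace ReviewPricing

/-! ### Concentration for independent, identically distributed coordinates -/

section Product

variable {X : Type*} [MeasurableSpace X]

/-- Overwriting the coordinates outside `A` by a fixed point does not change `f`, so `f` factors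
measurably through the restriction to `A`, and likewise `g` through `B`; restrictions to disjoint
sets of coordinates are independent. -/
lemma indepFun_of_dependsOn [Nonempty X] (ν : Measure X) [IsProbabilityMeasure ν]
    {α β : Type*} [MeasurableSpace α] [MeasurableSpace β] {f : (ℕ → X) → α} {g : (ℕ → X) → β}
    {A B : Finset ℕ} (hf : Measurable f) (hg : Measurable g) (hfA : DependsOn f A)
    (hgB : DependsOn g B) (hAB : Disjoint A B) :
    IndepFun f g (Measure.infinitePi fun _ : ℕ => ν) := by
  classical
  have hind : iIndepFun (fun (i : ℕ) (x : ℕ → X) => x i) (Measure.infinitePi fun _ : ℕ => ν) :=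
    iIndepFun_infinitePi (X := fun _ x => x) (fun _ => measurable_id)
  have h := hind.indepFun_finset A B hAB (fun i => measurable_pi_apply i)
  let x₀ : X := Classical.arbitrary X
  let ext : (C : Finset ℕ) → (C → X) → ℕ → X := fun C y i => if h : i ∈ C then y ⟨i, h⟩ else x₀
  have hext : ∀ C, Measurable (ext C) := by
    intro C
    refine measurable_pi_lambda _ fun i => ?_
    by_cases hi : i ∈ C
    · simp only [ext, hi, dite_true]
      exact measurable_pi_apply _
    · simp only [ext, hi, dite_false]
      exact measurable_const
  have h2 := h.comp (hf.comp (hext A)) (hg.comp (hext B))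
  have e1 : (f ∘ ext A) ∘ (fun (x : ℕ → X) (i : A) => x i) = f := by
    funext x
    refine hfA fun i hi => ?_
    have hi' : i ∈ A := by simpa using hi
    simp [ext, hi']
  have e2 : (g ∘ ext B) ∘ (fun (x : ℕ → X) (i : B) => x i) = g := by
    funext x
    refine hgB fun i hi => ?_
    have hi' : i ∈ B := by simpa using hi
    simp [ext, hi']
  rw [e1, e2] at h2
  exact h2

/-- Chernoff's bound for a sum over independent coordinates with a common law. -/
lemma chernoff_bound (ν : Measure X) [IsProbabilityMeasure ν] {f : X → ℝ} (hf : Measurable f)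
    (hint : Integrable (fun x => Real.exp (f x)) ν) {c : ℝ} (hc : ∫ x, Real.exp (f x) ∂ν ≤ Real.exp c)
    (I : Finset ℕ) (a : ℝ) :
    (Measure.infinitePi fun _ : ℕ => ν).real {x | a + I.card * c ≤ ∑ s ∈ I, f (x s)}
      ≤ Real.exp (-a) := by
  set μ := Measure.infinitePi fun _ : ℕ => ν
  have hmp : ∀ s : ℕ, MeasurePreserving (Function.eval s) μ ν := fun s =>
    measurePreserving_eval_infinitePi (fun _ : ℕ => ν) s
  have hind : iIndepFun (fun (i : ℕ) (x : ℕ → X) => f (x i)) μ :=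
    iIndepFun_infinitePi (X := fun _ => f) (fun _ => hf)
  have hm : ∀ i : ℕ, Measurable (fun x : ℕ → X => f (x i)) := fun i =>
    hf.comp (measurable_pi_apply i)
  have hI : ∀ s : ℕ, Integrable (fun x : ℕ → X => Real.exp (1 * f (x s))) μ := by
    intro s
    have := (hmp s).integrable_comp_of_integrable hint
    simpa [Function.comp_def] using this
  have hmgf : ∀ s : ℕ, mgf (fun x : ℕ → X => f (x s)) μ 1 ≤ Real.exp c := by
    intro s
    refine le_trans (le_of_eq ?_) hc
    rw [mgf, ← (hmp s).map_eq, integral_map (hmp s).measurable.aemeasurable]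
    · simp
    · exact (Real.measurable_exp.comp hf).aestronglyMeasurable
  have h1 := measure_ge_le_exp_mul_mgf (μ := μ) (X := ∑ s ∈ I, fun x : ℕ → X => f (x s)) (t := 1)
    (a + I.card * c) zero_le_one (hind.integrable_exp_mul_sum hm fun s _ => hI s)
  rw [hind.mgf_sum hm] at h1
  have h2 : ∏ s ∈ I, mgf (fun x : ℕ → X => f (x s)) μ 1 ≤ Real.exp (I.card * c) := by
    calc _ ≤ ∏ s ∈ I, Real.exp c := Finset.prod_le_prod (fun s _ => mgf_nonneg) fun s _ => hmgf s
      _ = Real.exp (I.card * c) := by rw [Finset.prod_const, ← Real.exp_nat_mul]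
  have h3 : {x : ℕ → X | a + I.card * c ≤ ∑ s ∈ I, f (x s)}
      = {x | a + I.card * c ≤ (∑ s ∈ I, fun x : ℕ → X => f (x s)) x} := by
    ext x; simp
  rw [h3]
  refine h1.trans ?_
  calc _ ≤ Real.exp (-1 * (a + I.card * c)) * Real.exp (I.card * c) := by gcongr
    _ = Real.exp (-a) := by rw [← Real.exp_add]; ring_nf

/-- The number of rounds of `I` whose outcome lies in `A`. -/
def hits (A : Set X) (I : Finset ℕ) (x : ℕ → X) : ℝ := ∑ s ∈ I, A.indicator (fun _ => (1 : ℝ)) (x s)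

lemma measurable_hits {A : Set X} (hA : MeasurableSet A) (I : Finset ℕ) : Measurable (hits A I) := by
  unfold hits
  refine Finset.measurable_sum _ fun s _ => ?_
  exact (measurable_const.indicator hA).comp (measurable_pi_apply s)

lemma dependsOn_hits {X : Type*} (A : Set X) (I : Finset ℕ) : DependsOn (hits A I) I := by
  intro x y h
  unfold hits
  exact Finset.sum_congr rfl fun s hs => by rw [h s (by simpa using hs)]

lemma integrable_exp_of_le {ν : Measure X} [IsProbabilityMeasure ν] {f : X → ℝ}
    (hf : Measurable f) {B : ℝ} (hB : ∀ x, f x ≤ B) : Integrable (fun x => Real.exp (f x)) ν := by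
  refine Integrable.of_bound (C := Real.exp B) (Real.measurable_exp.comp hf).aestronglyMeasurable
    (Filter.Eventually.of_forall fun x => ?_)
  rw [Real.norm_eq_abs, abs_of_pos (Real.exp_pos _)]
  exact Real.exp_le_exp.2 (hB x)

lemma integral_exp_mul_indicator (ν : Measure X) [IsProbabilityMeasure ν] {A : Set X}
    (hA : MeasurableSet A) (r : ℝ) :
    ∫ x, Real.exp (r * A.indicator (fun _ => (1 : ℝ)) x) ∂ν = 1 + ν.real A * (Real.exp r - 1) := by
  have : (fun x => Real.exp (r * A.indicator (fun _ => (1 : ℝ)) x))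
      = fun x => 1 + A.indicator (fun _ => (Real.exp r - 1)) x := by
    funext x
    by_cases hx : x ∈ A <;> simp [hx]
  rw [this, integral_add (integrable_const _) ((integrable_const _).indicator hA),
    integral_indicator_const _ hA]
  simp

/-- The moment `1 + q (e^r - 1)` of an indicator is at most `exp (q (e^r - 1))`. The sign of `r` is
free, so both tails come from this bound. -/
lemma hits_chernoff (ν : Measure X) [IsProbabilityMeasure ν] {A : Set X}
    (hA : MeasurableSet A) (I : Finset ℕ) (r a : ℝ) :
    (Measure.infinitePi fun _ : ℕ => ν).real
      {x | a + I.card * (ν.real A * (Real.exp r - 1)) ≤ r * hits A I x} ≤ Real.exp (-a) := by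
  have hm : Measurable fun x => r * A.indicator (fun _ => (1 : ℝ)) x :=
    (measurable_const.indicator hA).const_mul r
  have h := chernoff_bound ν hm (integrable_exp_of_le hm (B := |r|) fun x => by
      by_cases hx : x ∈ A <;> simp [hx, le_abs_self])
    (c := ν.real A * (Real.exp r - 1)) (by
      rw [integral_exp_mul_indicator ν hA]
      linarith [Real.add_one_le_exp (ν.real A * (Real.exp r - 1))]) I a
  simpa only [hits, Finset.mul_sum] using h

/-- A lower tail bound on the number of hits. -/
lemma hits_lower_tail (ν : Measure X) [IsProbabilityMeasure ν] {A : Set X}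
    (hA : MeasurableSet A) (I : Finset ℕ) {r a b : ℝ} (hr0 : 0 ≤ r)
    (hb : a + r * b ≤ I.card * ν.real A * (r - r ^ 2 / 2)) :
    (Measure.infinitePi fun _ : ℕ => ν).real {x | hits A I x ≤ b} ≤ Real.exp (-a) := by
  refine le_trans (measureReal_mono ?_) (hits_chernoff ν hA I (-r) a)
  intro x hx
  simp only [Set.mem_ofPred_eq] at hx ⊢
  -- Since `e^r ≥ 1 + r + r²/2` and `(1 + r + r²/2)(1 - r + r²/2) = 1 + r⁴/4 ≥ 1`.
  have he : Real.exp (-r) ≤ 1 - r + r ^ 2 / 2 := by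
    have h1 := Real.quadratic_le_exp_of_nonneg hr0
    have h2 : 0 < 1 - r + r ^ 2 / 2 := by nlinarith [sq_nonneg (r - 1)]
    rw [Real.exp_neg, inv_le_comm₀ (Real.exp_pos _) h2]
    refine le_trans ?_ h1
    rw [inv_le_iff_one_le_mul₀ h2]
    nlinarith [sq_nonneg (r ^ 2)]
  have h0 : (0 : ℝ) ≤ I.card * ν.real A := by positivity
  nlinarith [mul_le_mul_of_nonneg_left hx hr0]

/-- An upper tail bound on the number of hits. -/
lemma hits_upper_tail (ν : Measure X) [IsProbabilityMeasure ν] {A : Set X}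
    (hA : MeasurableSet A) (I : Finset ℕ) {r a b : ℝ} (hr0 : 0 ≤ r) (hr : r ≤ 1)
    (hb : a + I.card * ν.real A * (r + r ^ 2) ≤ r * b) :
    (Measure.infinitePi fun _ : ℕ => ν).real {x | b ≤ hits A I x} ≤ Real.exp (-a) := by
  refine le_trans (measureReal_mono ?_) (hits_chernoff ν hA I r a)
  intro x hx
  simp only [Set.mem_ofPred_eq] at hx ⊢
  have he : Real.exp r ≤ 1 + r + r ^ 2 := by
    have := Real.abs_exp_sub_one_sub_id_le (x := r) (by rwa [abs_of_nonneg hr0])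
    linarith [le_abs_self (Real.exp r - 1 - r)]
  have h0 : (0 : ℝ) ≤ I.card * ν.real A := by positivity
  nlinarith [mul_le_mul_of_nonneg_left hx hr0]

/-- Hoeffding's lemma for variables in the unit interval. -/
lemma integral_exp_le_of_mem_unit (ν : Measure X) [IsProbabilityMeasure ν] {f : X → ℝ}
    (hf : Measurable f) (h01 : ∀ x, f x ∈ Set.Icc (0 : ℝ) 1) (r : ℝ) :
    ∫ x, Real.exp (r * (f x - ∫ y, f y ∂ν)) ∂ν ≤ Real.exp (r ^ 2 / 8) := by
  have h := (hasSubgaussianMGF_of_mem_Icc (μ := ν) hf.aemeasurable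
    (Filter.Eventually.of_forall h01)).mgf_le r
  refine h.trans (le_of_eq ?_)
  congr 1
  simp
  ring

/-- Hoeffding's inequality for the number of hits. -/
lemma hits_hoeffding (ν : Measure X) [IsProbabilityMeasure ν] {A : Set X}
    (hA : MeasurableSet A) (I : Finset ℕ) (r a : ℝ) :
    (Measure.infinitePi fun _ : ℕ => ν).real
      {x | a + I.card * (r ^ 2 / 8) ≤ r * (hits A I x - I.card * ν.real A)} ≤ Real.exp (-a) := by
  set f : X → ℝ := A.indicator (fun _ => (1 : ℝ)) with hfdef
  have hf : Measurable f := measurable_const.indicator hA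
  have h01 : ∀ x, f x ∈ Set.Icc (0 : ℝ) 1 := by
    intro x
    by_cases hx : x ∈ A <;> simp [f, hx]
  have hmean : ∫ y, f y ∂ν = ν.real A := by
    rw [hfdef, integral_indicator_const _ hA]; simp
  have hm : Measurable fun x => r * (f x - ν.real A) := (hf.sub_const _).const_mul r
  have h := chernoff_bound ν hm (integrable_exp_of_le hm (B := |r|) fun x => by
      have h1 := h01 x
      have h2 : |f x - ν.real A| ≤ 1 := by
        have := measureReal_nonneg (μ := ν) (s := A)
        have h3 : ν.real A ≤ 1 := measureReal_le_one
        rw [abs_le]; constructor <;> linarith [h1.1, h1.2]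
      calc r * (f x - ν.real A) ≤ |r * (f x - ν.real A)| := le_abs_self _
        _ = |r| * |f x - ν.real A| := abs_mul _ _
        _ ≤ |r| * 1 := by gcongr
        _ = |r| := mul_one _)
    (c := r ^ 2 / 8) (by
      have := integral_exp_le_of_mem_unit ν hf h01 r
      rwa [hmean] at this) I a
  refine le_trans (le_of_eq ?_) h
  congr 1
  ext x
  simp only [Set.mem_ofPred_eq, hits, ← Finset.mul_sum, Finset.sum_sub_distrib, Finset.sum_const,
    nsmul_eq_mul, f]

/-- Two-sided form of Hoeffding's inequality, with deviation `m ρ` for `2 m ρ ^ 2 = a`. -/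
lemma hits_hoeffding_abs (ν : Measure X) [IsProbabilityMeasure ν] {A : Set X}
    (hA : MeasurableSet A) (I : Finset ℕ) {ρ a : ℝ} (hρ : 0 ≤ ρ) (ha : a ≤ 2 * I.card * ρ ^ 2) :
    (Measure.infinitePi fun _ : ℕ => ν).real
      {x | I.card * ρ ≤ |hits A I x - I.card * ν.real A|} ≤ 2 * Real.exp (-a) := by
  -- `r = 4ρ` maximises `r m ρ - m r²/8`, with value `2 m ρ²`.
  have h1 := hits_hoeffding ν hA I (4 * ρ) a
  have h2 := hits_hoeffding ν hA I (-(4 * ρ)) a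
  have hsub : {x | I.card * ρ ≤ |hits A I x - I.card * ν.real A|} ⊆
      {x | a + I.card * ((4 * ρ) ^ 2 / 8) ≤ (4 * ρ) * (hits A I x - I.card * ν.real A)} ∪
      {x | a + I.card * ((-(4 * ρ)) ^ 2 / 8) ≤ (-(4 * ρ)) * (hits A I x - I.card * ν.real A)} := by
    intro x hx
    simp only [Set.mem_ofPred_eq, Set.mem_union] at hx ⊢
    rcases le_abs.1 hx with h | h
    · left
      nlinarith [mul_le_mul_of_nonneg_left h hρ]
    · right
      nlinarith [mul_le_mul_of_nonneg_left h hρ]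
  calc _ ≤ _ := measureReal_mono hsub
    _ ≤ _ := measureReal_union_le _ _
    _ ≤ 2 * Real.exp (-a) := by linarith

end Product

/-! ### Arrivals, values and typical sequences of buyers -/

variable {d : ℕ}

/-- The number of buyers of type `i` in the rounds `1, …, t`. -/
def arrivals (i : Fin d) (t : ℕ) (x : ℕ → Review d) : ℝ := hits {r | r.1 = i} (Finset.Icc 1 t) x

/-- The sum of the values of the buyers of type `i` in the rounds `1, …, t`. -/
def valueSum (i : Fin d) (t : ℕ) (x : ℕ → Review d) : ℝ :=
  ∑ s ∈ Finset.Icc 1 t, if (x s).1 = i then ((x s).2 : ℝ) else 0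

/-- The types that arrive in at least a `3λ/4` fraction of the first `n` rounds. -/
def frequentTypes (lam : ℝ) (n : ℕ) (x : ℕ → Review d) : Finset (Fin d) :=
  {i | 3 * lam / 4 ≤ arrivals i n x / n}

/-- The types of `Q` with ex-ante value at least that of `i`. -/
def above (θ : Fin d → ℝ) (Q : Finset (Fin d)) (i : Fin d) : Finset (Fin d) := {j ∈ Q | θ i ≤ θ j}

/-- The probability of the types in `S`. -/
def mass (P : PMF (Fin d)) (S : Finset (Fin d)) : ℝ := ∑ j ∈ S, (P j).toReal

lemma mass_nonneg (P : PMF (Fin d)) (S : Finset (Fin d)) : 0 ≤ mass P S :=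
  Finset.sum_nonneg fun _ _ => ENNReal.toReal_nonneg

lemma mass_mono (P : PMF (Fin d)) {S S' : Finset (Fin d)} (h : S ⊆ S') : mass P S ≤ mass P S' :=
  Finset.sum_le_sum_of_subset_of_nonneg h fun _ _ _ => ENNReal.toReal_nonneg

lemma toMeasure_real_eq_mass (P : PMF (Fin d)) (S : Finset (Fin d)) :
    P.toMeasure.real (S : Set (Fin d)) = mass P S := by
  rw [measureReal_def, PMF.toMeasure_apply_finset, mass,
    ENNReal.toReal_sum fun i _ => PMF.apply_ne_top P i]

lemma mass_le_one (P : PMF (Fin d)) (S : Finset (Fin d)) : mass P S ≤ 1 := by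
  rw [← toMeasure_real_eq_mass]
  exact measureReal_le_one

lemma measurableSet_fst_mem (S : Set (Fin d)) : MeasurableSet {r : Review d | r.1 ∈ S} :=
  measurable_fst (MeasurableSet.of_discrete (s := S))

lemma buyerLaw_real_fst_mem (P : PMF (Fin d)) (D : Kernel (Fin d) unitInterval) [IsMarkovKernel D]
    (S : Finset (Fin d)) : (buyerLaw P D).real {r | r.1 ∈ S} = mass P S := by
  rw [← toMeasure_real_eq_mass, ← Measure.fst_compProd P.toMeasure D, measureReal_def,
    measureReal_def, Measure.fst_apply MeasurableSet.of_discrete]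
  rfl

lemma buyerLaw_real_fst_eq (P : PMF (Fin d)) (D : Kernel (Fin d) unitInterval) [IsMarkovKernel D]
    (i : Fin d) : (buyerLaw P D).real {r | r.1 = i} = (P i).toReal := by
  have := buyerLaw_real_fst_mem P D {i}
  simpa [mass] using this

lemma measurableSet_fst_eq (i : Fin d) : MeasurableSet {r : Review d | r.1 = i} :=
  measurableSet_fst_mem {i}

lemma hits_eq_card {X : Type*} (A : Set X) [DecidablePred (· ∈ A)] (I : Finset ℕ) (x : ℕ → X) :
    hits A I x = ({s ∈ I | x s ∈ A}.card : ℝ) := by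
  simp only [hits, Set.indicator_apply, Finset.sum_boole]

/-- The properties of the sequence of buyers on which the regret bound rests. -/
structure Typical (P : PMF (Fin d)) (θ : Fin d → ℝ) (lam : ℝ) (n T : ℕ) (x : ℕ → Review d) :
    Prop where
  frequent : ∀ i, lam ≤ (P i).toReal → 3 * lam / 4 * n ≤ arrivals i n x
  rare : ∀ i, (P i).toReal < lam / 2 → arrivals i n x < 3 * lam / 4 * n
  arrivals_ge : ∀ i, lam / 2 ≤ (P i).toReal → ∀ t, n ≤ t → t < T →
    t * (P i).toReal / 2 ≤ arrivals i t x
  values_ge : ∀ i t, t < T →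
    θ i * arrivals i t x - √(arrivals i t x * (3 * Real.log (d * T)) / 2) ≤ valueSum i t x
  estimate : ∀ i t, n < t → t < T →
    |hits {r | r.1 ∈ above θ (frequentTypes lam n x) i} (Finset.Ioc n t) x
      - (Finset.Ioc n t).card * mass P (above θ (frequentTypes lam n x) i)|
      ≤ (Finset.Ioc n t).card * √(Real.log (d * (T : ℝ) ^ 2) / (2 * (Finset.Ioc n t).card))

/-! ### Atypical sequences are unlikely -/

section Bounds

variable (P : PMF (Fin d)) (D : Kernel (Fin d) unitInterval) [IsMarkovKernel D]

/-- The law of the sequence of buyers. -/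
abbrev buyersLaw : Measure (ℕ → Review d) := Measure.infinitePi fun _ : ℕ => buyerLaw P D

/-- With `r = 1/4` the tail bound asks for `L + (6/32) λn ≤ (7/32) λn`. The gap `λn/32` is what the
constant `32` in the length of the first phase pays for; the upper tail for rare types, with `5/32`
against `6/32`, has the same gap. -/
lemma infrequent_prob_le {i : Fin d} {lam L : ℝ} {n : ℕ} (hn : 32 * L ≤ lam * n)
    (hi : lam ≤ (P i).toReal) :
    (buyersLaw P D).real {x | arrivals i n x ≤ 3 * lam / 4 * n} ≤ Real.exp (-L) := by
  refine hits_lower_tail (buyerLaw P D) (measurableSet_fst_eq i) _ (r := 1 / 4) (by norm_num) ?_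
  rw [buyerLaw_real_fst_eq, Nat.card_Icc]
  have : (n : ℝ) * lam ≤ n * (P i).toReal := by gcongr
  push_cast [Nat.add_sub_cancel]
  linarith

lemma not_rare_prob_le {i : Fin d} {lam L : ℝ} {n : ℕ} (hn : 32 * L ≤ lam * n)
    (hi : (P i).toReal < lam / 2) :
    (buyersLaw P D).real {x | 3 * lam / 4 * n ≤ arrivals i n x} ≤ Real.exp (-L) := by
  refine hits_upper_tail (buyerLaw P D) (measurableSet_fst_eq i) _ (r := 1 / 4) (by norm_num)
    (by norm_num) ?_
  rw [buyerLaw_real_fst_eq, Nat.card_Icc]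
  have : (n : ℝ) * (P i).toReal ≤ n * (lam / 2) := by gcongr
  push_cast [Nat.add_sub_cancel]
  linarith

lemma few_arrivals_prob_le {i : Fin d} {lam L : ℝ} {n t : ℕ} (hL : 0 ≤ L) (hn : 32 * L ≤ lam * n)
    (hi : lam / 2 ≤ (P i).toReal) (hnt : n ≤ t) :
    (buyersLaw P D).real {x | arrivals i t x ≤ t * (P i).toReal / 2} ≤ Real.exp (-L) := by
  refine hits_lower_tail (buyerLaw P D) (measurableSet_fst_eq i) _ (r := 1 / 2) (by norm_num) ?_
  rw [buyerLaw_real_fst_eq, Nat.card_Icc]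
  have h1 : (n : ℝ) * (lam / 2) ≤ n * (P i).toReal := by gcongr
  have h2 : (n : ℝ) * (P i).toReal ≤ t * (P i).toReal := by gcongr
  push_cast [Nat.add_sub_cancel]
  linarith

lemma measurable_deviation (θ : Fin d → ℝ) (i : Fin d) (s : ℝ) : Measurable fun r : Review d =>
    if r.1 = i then -s * ((r.2 : ℝ) - θ i) - s ^ 2 / 8 else 0 :=
  Measurable.ite (measurableSet_fst_eq i) (by fun_prop) measurable_const

lemma integrable_exp_deviation (θ : Fin d → ℝ) (i : Fin d) (s : ℝ) :
    Integrable (fun r : Review d =>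
      Real.exp (if r.1 = i then -s * ((r.2 : ℝ) - θ i) - s ^ 2 / 8 else 0)) (buyerLaw P D) := by
  refine integrable_exp_of_le (measurable_deviation θ i s) (B := |s| * (1 + |θ i|)) fun r => ?_
  split_ifs
  · have h1 : |(r.2 : ℝ) - θ i| ≤ 1 + |θ i| := by
      refine (abs_sub _ _).trans ?_
      rw [abs_of_nonneg r.2.2.1]
      linarith [r.2.2.2]
    calc _ ≤ -s * ((r.2 : ℝ) - θ i) := by nlinarith [sq_nonneg s]
      _ ≤ |-s * ((r.2 : ℝ) - θ i)| := le_abs_self _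
      _ = |s| * |(r.2 : ℝ) - θ i| := by rw [abs_mul, abs_neg]
      _ ≤ _ := by gcongr
  · positivity

/-- Hoeffding's lemma bounds the moment of the centred value by `e^(s²/8)`, which the subtracted
term cancels, and a buyer of another type contributes `e^0`. The compensation is charged only when
type `i` arrives, so the random number of arrivals need not be conditioned on. -/
lemma integral_exp_deviation_le {θ : Fin d → ℝ} (hθ : ∀ i, ∫ v, (v : ℝ) ∂(D i) = θ i) (i : Fin d)
    (s : ℝ) :
    ∫ r, Real.exp (if r.1 = i then -s * ((r.2 : ℝ) - θ i) - s ^ 2 / 8 else 0) ∂(buyerLaw P D)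
      ≤ Real.exp 0 := by
  rw [Measure.integral_compProd (integrable_exp_deviation P D θ i s), Real.exp_zero]
  have key : ∀ j, ∫ v, Real.exp (if j = i then -s * ((v : ℝ) - θ i) - s ^ 2 / 8 else 0) ∂(D j)
      ≤ 1 := by
    intro j
    by_cases hj : j = i
    · subst hj
      have h := integral_exp_le_of_mem_unit (D j) (f := fun v : unitInterval => (v : ℝ))
        measurable_subtype_coe (fun v => v.2) (-s)
      rw [hθ] at h
      simp only [if_true, sub_eq_add_neg _ (s ^ 2 / 8), Real.exp_add]
      rw [integral_mul_const]
      calc _ ≤ Real.exp ((-s) ^ 2 / 8) * Real.exp (-(s ^ 2 / 8)) := by gcongr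
        _ = 1 := by rw [← Real.exp_add]; simp
    · simp [hj]
  calc _ ≤ ∫ _, (1 : ℝ) ∂P.toMeasure :=
        integral_mono Integrable.of_finite (integrable_const _) key
    _ = 1 := by simp

/-- The best exponent depends on the random number of arrivals. Chernoff's bound is therefore
applied with one fixed exponent for each possible number `k`, and the union over `k ≤ t` costs the
factor `t`. -/
lemma low_values_prob_le {θ : Fin d → ℝ} (hθ : ∀ i, ∫ v, (v : ℝ) ∂(D i) = θ i) (i : Fin d)
    {L : ℝ} (hL : 0 ≤ L) (t : ℕ) :
    (buyersLaw P D).real {x | valueSum i t x < θ i * arrivals i t x - √(arrivals i t x * L / 2)}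
      ≤ t * Real.exp (-L) := by
  classical
  let f : ℝ → Review d → ℝ := fun s r =>
    if r.1 = i then -s * ((r.2 : ℝ) - θ i) - s ^ 2 / 8 else 0
  -- The choice for which `s √(kL/2) - k s²/8 = L`.
  let s : ℕ → ℝ := fun k => 4 * √(k * L / 2) / k
  have hch : ∀ k, (buyersLaw P D).real {x | L ≤ ∑ u ∈ Finset.Icc 1 t, f (s k) (x u)}
      ≤ Real.exp (-L) := by
    intro k
    have := chernoff_bound (buyerLaw P D) (measurable_deviation θ i (s k))
      (integrable_exp_deviation P D θ i (s k)) (integral_exp_deviation_le P D hθ i (s k)) (Finset.Icc 1 t) L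
    simpa [f] using this
  have hsub : {x | valueSum i t x < θ i * arrivals i t x - √(arrivals i t x * L / 2)} ⊆
      ⋃ k ∈ Finset.Icc 1 t, {x | L ≤ ∑ u ∈ Finset.Icc 1 t, f (s k) (x u)} := by
    intro x hx
    simp only [Set.mem_ofPred_eq, Set.mem_iUnion] at hx ⊢
    set N : ℕ := {u ∈ Finset.Icc 1 t | (x u).1 = i}.card with hN
    have hA : arrivals i t x = N := hits_eq_card {r : Review d | r.1 = i} _ x
    have hV : valueSum i t x = ∑ u ∈ Finset.Icc 1 t with (x u).1 = i, ((x u).2 : ℝ) := by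
      rw [valueSum, Finset.sum_filter]
    rw [hA, hV] at hx
    -- Without arrivals both sides of the strict inequality vanish.
    have hN1 : 1 ≤ N := by
      by_contra h
      have h0 : N = 0 := by omega
      have h0' : ({u ∈ Finset.Icc 1 t | (x u).1 = i} : Finset ℕ) = ∅ := Finset.card_eq_zero.1 h0
      rw [h0', h0] at hx
      simp at hx
    have hNt : N ≤ t := by
      refine (Finset.card_filter_le _ _).trans ?_
      simp
    refine ⟨N, Finset.mem_Icc.2 ⟨hN1, hNt⟩, ?_⟩
    have hsum : ∑ u ∈ Finset.Icc 1 t, f (s N) (x u)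
        = -s N * (∑ u ∈ Finset.Icc 1 t with (x u).1 = i, ((x u).2 : ℝ) - θ i * N)
          - N * (s N ^ 2 / 8) := by
      simp only [f]
      rw [← Finset.sum_filter, Finset.sum_sub_distrib, ← Finset.mul_sum, Finset.sum_sub_distrib]
      simp only [Finset.sum_const, nsmul_eq_mul, ← hN]
      ring
    rw [hsum]
    have hNpos : (0 : ℝ) < N := by exact_mod_cast hN1
    have ha : √(N * L / 2) ^ 2 = N * L / 2 := Real.sq_sqrt (by positivity)
    have hs : 0 ≤ s N := by simp only [s]; positivity
    have h1 : s N * √(N * L / 2) - N * (s N ^ 2 / 8) = L := by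
      simp only [s]
      field_simp
      nlinarith [ha]
    nlinarith [mul_le_mul_of_nonneg_left hx.le hs]
  calc _ ≤ (buyersLaw P D).real
        (⋃ k ∈ Finset.Icc 1 t, {x | L ≤ ∑ u ∈ Finset.Icc 1 t, f (s k) (x u)}) :=
        measureReal_mono hsub (measure_ne_top _ _)
    _ ≤ ∑ k ∈ Finset.Icc 1 t, _ := measureReal_biUnion_finset_le _ _
    _ ≤ ∑ k ∈ Finset.Icc 1 t, Real.exp (-L) := Finset.sum_le_sum fun k _ => hch k
    _ = t * Real.exp (-L) := by simp

lemma measurableSet_frequentTypes_eq (lam : ℝ) (n : ℕ) (A : Finset (Fin d)) :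
    MeasurableSet {x : ℕ → Review d | frequentTypes lam n x = A} := by
  have : {x : ℕ → Review d | frequentTypes lam n x = A}
      = ⋂ i, {x | 3 * lam / 4 ≤ arrivals i n x / n ↔ i ∈ A} := by
    ext x
    simp [frequentTypes, Finset.ext_iff]
  rw [this]
  refine MeasurableSet.iInter fun i => ?_
  have h : MeasurableSet {x : ℕ → Review d | 3 * lam / 4 ≤ arrivals i n x / n} :=
    measurableSet_le measurable_const
      ((measurable_hits (measurableSet_fst_eq i) _).div_const _)
  by_cases hi : i ∈ A
  · have : {x : ℕ → Review d | 3 * lam / 4 ≤ arrivals i n x / n ↔ i ∈ A}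
        = {x | 3 * lam / 4 ≤ arrivals i n x / n} := by ext; simp [hi]
    rw [this]
    exact h
  · have : {x : ℕ → Review d | 3 * lam / 4 ≤ arrivals i n x / n ↔ i ∈ A}
        = {x | 3 * lam / 4 ≤ arrivals i n x / n}ᶜ := by ext; simp [hi]
    rw [this]
    exact h.compl

lemma dependsOn_frequentTypes (lam : ℝ) (n : ℕ) :
    DependsOn (frequentTypes (d := d) lam n) (Finset.Icc 1 n) := by
  intro x y h
  unfold frequentTypes arrivals
  refine Finset.filter_congr fun i _ => ?_
  rw [dependsOn_hits _ _ h]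

/-- The random set `Q` depends on the rounds up to `n` and the hits on the rounds after `n`. Given
`Q = A`, Hoeffding's inequality applies to the fixed set `above θ A i`; the weights `Pr[Q = A]` sum
to one, so there is no factor `2^d` as in a union bound over `A`. -/
lemma bad_estimate_prob_le (θ : Fin d → ℝ) (lam : ℝ) {L : ℝ} (hL : 0 ≤ L) (n t : ℕ) (hnt : n < t)
    (i : Fin d) :
    (buyersLaw P D).real {x | (Finset.Ioc n t).card * √(L / (2 * (Finset.Ioc n t).card)) ≤
      |hits {r | r.1 ∈ above θ (frequentTypes lam n x) i} (Finset.Ioc n t) x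
      - (Finset.Ioc n t).card * mass P (above θ (frequentTypes lam n x) i)|}
      ≤ 2 * Real.exp (-L) := by
  classical
  obtain ⟨i₀⟩ : Nonempty (Fin d) := ⟨i⟩
  have : Nonempty (Review d) := ⟨(i₀, 0)⟩
  let _ : MeasurableSpace (Finset (Fin d)) := ⊤
  set c : ℝ := ((Finset.Ioc n t).card : ℝ) with hcdef
  have hc : 0 < c := by
    simp only [hcdef, Nat.card_Ioc]
    exact_mod_cast Nat.sub_pos_of_lt hnt
  let F : (ℕ → Review d) → Finset (Fin d) := frequentTypes lam n
  have hF : Measurable F := measurable_to_countable' fun A => measurableSet_frequentTypes_eq lam n A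
  let B : Finset (Fin d) → Set (ℕ → Review d) := fun A =>
    {x | c * √(L / (2 * c)) ≤ |hits {r | r.1 ∈ above θ A i} (Finset.Ioc n t) x
      - c * mass P (above θ A i)|}
  have hB : ∀ A, (buyersLaw P D).real (B A) ≤ 2 * Real.exp (-L) := by
    intro A
    have := hits_hoeffding_abs (buyerLaw P D) (A := {r : Review d | r.1 ∈ above θ A i})
      (measurableSet_fst_mem (above θ A i : Set (Fin d))) (Finset.Ioc n t)
      (ρ := √(L / (2 * c))) (a := L) (Real.sqrt_nonneg _) (by
        rw [Real.sq_sqrt (by positivity)]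
        change L ≤ 2 * c * _
        field_simp
        exact le_rfl)
    rw [buyerLaw_real_fst_mem] at this
    exact this
  have hmul : ∀ A, (buyersLaw P D).real (F ⁻¹' {A} ∩ B A)
      = (buyersLaw P D).real (F ⁻¹' {A}) * (buyersLaw P D).real (B A) := by
    intro A
    let g : (ℕ → Review d) → ℝ := hits {r | r.1 ∈ above θ A i} (Finset.Ioc n t)
    have hg : Measurable g := measurable_hits (measurableSet_fst_mem (above θ A i : Set (Fin d))) _
    have hind : IndepFun F g (buyersLaw P D) :=
      indepFun_of_dependsOn (buyerLaw P D) hF hg (dependsOn_frequentTypes lam n)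
        (dependsOn_hits _ _) (by
          rw [Finset.disjoint_left]
          intro a ha hb
          simp only [Finset.mem_Icc, Finset.mem_Ioc] at ha hb
          omega)
    have hs : MeasurableSet {y : ℝ | c * √(L / (2 * c)) ≤ |y - c * mass P (above θ A i)|} :=
      measurableSet_le measurable_const (by fun_prop)
    have := hind.measure_inter_preimage_eq_mul {A} _ (measurableSet_singleton A) hs
    rw [measureReal_def, measureReal_def, measureReal_def, ← ENNReal.toReal_mul]
    exact congrArg ENNReal.toReal this
  have hsub : {x | c * √(L / (2 * c)) ≤
      |hits {r | r.1 ∈ above θ (frequentTypes lam n x) i} (Finset.Ioc n t) x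
      - c * mass P (above θ (frequentTypes lam n x) i)|}
      ⊆ ⋃ A ∈ (Finset.univ : Finset (Finset (Fin d))), F ⁻¹' {A} ∩ B A := by
    intro x hx
    simp only [Set.mem_iUnion]
    exact ⟨F x, Finset.mem_univ _, rfl, hx⟩
  have htot : ∑ A : Finset (Fin d), (buyersLaw P D).real (F ⁻¹' {A}) = 1 := by
    rw [sum_measureReal_preimage_singleton _ fun A _ => hF (measurableSet_singleton A)]
    simp
  calc _ ≤ _ := measureReal_mono hsub (measure_ne_top _ _)
    _ ≤ ∑ A : Finset (Fin d), (buyersLaw P D).real (F ⁻¹' {A} ∩ B A) :=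
      measureReal_biUnion_finset_le _ _
    _ ≤ ∑ A : Finset (Fin d), (buyersLaw P D).real (F ⁻¹' {A}) * (2 * Real.exp (-L)) := by
      refine Finset.sum_le_sum fun A _ => ?_
      rw [hmul]
      exact mul_le_mul_of_nonneg_left (hB A) measureReal_nonneg
    _ = 2 * Real.exp (-L) := by rw [← Finset.sum_mul, htot, one_mul]

/-- An atypical sequence of buyers has probability at most `6 / T`. -/
lemma not_typical_prob_le {θ : Fin d → ℝ} (hθ : ∀ i, ∫ v, (v : ℝ) ∂(D i) = θ i) {lam : ℝ}
    {n T : ℕ} (hd : 1 ≤ d) (hT : 1 ≤ T)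
    (hn : 32 * Real.log (d * (T : ℝ) ^ 2) ≤ lam * n) :
    (buyersLaw P D).real {x | ¬ Typical P θ lam n T x} ≤ 6 / T := by
  classical
  have hd' : (1 : ℝ) ≤ d := by exact_mod_cast hd
  have hT' : (1 : ℝ) ≤ T := by exact_mod_cast hT
  set L : ℝ := Real.log (d * (T : ℝ) ^ 2) with hL
  have hL0 : 0 ≤ L := Real.log_nonneg (by nlinarith)
  have hexp : Real.exp (-L) = 1 / (d * (T : ℝ) ^ 2) := by
    rw [Real.exp_neg, Real.exp_log (by positivity), one_div]
  have hlog0 : 0 ≤ Real.log (d * T) := Real.log_nonneg (by nlinarith)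
  -- The factor `3` in the deviation of the values absorbs the extra factor `t ≤ T` of
  -- `low_values_prob_le`.
  have hexp3 : Real.exp (-(3 * Real.log (d * T))) ≤ 1 / (d * (T : ℝ) ^ 3) := by
    rw [Real.exp_neg, ← one_div]
    have : Real.exp (3 * Real.log (d * T)) = (d * T : ℝ) ^ 3 := by
      rw [mul_comm, Real.exp_mul, Real.exp_log (by positivity)]
      norm_cast
    rw [this, mul_pow]
    gcongr
    exact le_self_pow₀ hd' (by norm_num)
  let E1 : Fin d → Set (ℕ → Review d) := fun i =>
    {x | lam ≤ (P i).toReal ∧ arrivals i n x ≤ 3 * lam / 4 * n}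
  let E2 : Fin d → Set (ℕ → Review d) := fun i =>
    {x | (P i).toReal < lam / 2 ∧ 3 * lam / 4 * n ≤ arrivals i n x}
  let E3 : Fin d → ℕ → Set (ℕ → Review d) := fun i t =>
    {x | (lam / 2 ≤ (P i).toReal ∧ n ≤ t) ∧ arrivals i t x ≤ t * (P i).toReal / 2}
  let E4 : Fin d → ℕ → Set (ℕ → Review d) := fun i t =>
    {x | valueSum i t x
      < θ i * arrivals i t x - √(arrivals i t x * (3 * Real.log (d * T)) / 2)}
  let E5 : Fin d → ℕ → Set (ℕ → Review d) := fun i t =>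
    {x | n < t ∧ (Finset.Ioc n t).card * √(L / (2 * (Finset.Ioc n t).card)) ≤
      |hits {r | r.1 ∈ above θ (frequentTypes lam n x) i} (Finset.Ioc n t) x
      - (Finset.Ioc n t).card * mass P (above θ (frequentTypes lam n x) i)|}
  have cond : ∀ (p : Prop) (f : (ℕ → Review d) → Prop) (b : ℝ), 0 ≤ b →
      (p → (buyersLaw P D).real {x | f x} ≤ b) → (buyersLaw P D).real {x | p ∧ f x} ≤ b := by
    intro p f b hb h
    by_cases hp : p
    · simpa [hp] using h hp
    · simpa [hp] using hb
  have b1 : ∀ i, (buyersLaw P D).real (E1 i) ≤ Real.exp (-L) := fun i =>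
    cond _ _ _ (Real.exp_pos _).le fun h => infrequent_prob_le P D hn h
  have b2 : ∀ i, (buyersLaw P D).real (E2 i) ≤ Real.exp (-L) := fun i =>
    cond _ _ _ (Real.exp_pos _).le fun h => not_rare_prob_le P D hn h
  have b3 : ∀ i t, (buyersLaw P D).real (E3 i t) ≤ Real.exp (-L) := fun i t =>
    cond _ _ _ (Real.exp_pos _).le fun h => few_arrivals_prob_le P D hL0 hn h.1 h.2
  have b4 : ∀ i t, t < T → (buyersLaw P D).real (E4 i t) ≤ Real.exp (-L) := by
    intro i t ht
    refine (low_values_prob_le P D hθ i (by positivity) t).trans ?_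
    calc (t : ℝ) * Real.exp (-(3 * Real.log (d * T))) ≤ T * (1 / (d * (T : ℝ) ^ 3)) := by
          gcongr
      _ = Real.exp (-L) := by rw [hexp]; field_simp
  have b5 : ∀ i t, (buyersLaw P D).real (E5 i t) ≤ 2 * Real.exp (-L) := fun i t =>
    cond _ _ _ (by positivity) fun h => bad_estimate_prob_le P D θ lam hL0 n t h i
  -- Each type costs `2 e^(-L)`, each pair of a type and a round `(1 + 1 + 2) e^(-L)`. With `e^(-L)
  -- = 1/(dT²)` the total is at most `6/T`.
  let S1 : Set (ℕ → Review d) := ⋃ i ∈ (Finset.univ : Finset (Fin d)), (E1 i ∪ E2 i)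
  let S2 : Set (ℕ → Review d) := ⋃ p ∈ (Finset.univ : Finset (Fin d)) ×ˢ Finset.range T,
    (E3 p.1 p.2 ∪ E4 p.1 p.2 ∪ E5 p.1 p.2)
  have hsub : {x | ¬ Typical P θ lam n T x} ⊆ S1 ∪ S2 := by
    intro x hx
    by_contra hc
    simp only [Set.mem_union, not_or, S1, S2, Set.mem_iUnion, not_exists, Finset.mem_univ,
      true_implies, Finset.mem_product, Finset.mem_range, true_and, Prod.forall] at hc
    obtain ⟨hc1, hc2⟩ := hc
    refine hx ⟨fun i hi => ?_, fun i hi => ?_, fun i hi t hnt htT => ?_, fun i t htT => ?_,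
      fun i t hnt htT => ?_⟩
    · by_contra h
      exact (hc1 i).1 ⟨hi, (not_le.1 h).le⟩
    · by_contra h
      exact (hc1 i).2 ⟨hi, not_lt.1 h⟩
    · by_contra h
      exact (hc2 i t htT).1.1 ⟨⟨hi, hnt⟩, (not_le.1 h).le⟩
    · by_contra h
      exact (hc2 i t htT).1.2 (not_le.1 h)
    · by_contra h
      exact (hc2 i t htT).2 ⟨hnt, (not_le.1 h).le⟩
  have m1 : (buyersLaw P D).real S1 ≤ d * (2 * Real.exp (-L)) := by
    calc _ ≤ ∑ i : Fin d, (buyersLaw P D).real (E1 i ∪ E2 i) := measureReal_biUnion_finset_le _ _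
      _ ≤ ∑ i : Fin d, 2 * Real.exp (-L) := Finset.sum_le_sum fun i _ => by
          linarith [measureReal_union_le (μ := buyersLaw P D) (E1 i) (E2 i), b1 i, b2 i]
      _ = _ := by simp
  have m2 : (buyersLaw P D).real S2 ≤ (d * T) * (4 * Real.exp (-L)) := by
    calc _ ≤ ∑ p ∈ (Finset.univ : Finset (Fin d)) ×ˢ Finset.range T, _ :=
        measureReal_biUnion_finset_le _ _
      _ ≤ ∑ p ∈ (Finset.univ : Finset (Fin d)) ×ˢ Finset.range T, 4 * Real.exp (-L) := by
          refine Finset.sum_le_sum fun p hp => ?_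
          have hpT : p.2 < T := by simpa using hp
          linarith [measureReal_union_le (μ := buyersLaw P D) (E3 p.1 p.2 ∪ E4 p.1 p.2)
              (E5 p.1 p.2),
            measureReal_union_le (μ := buyersLaw P D) (E3 p.1 p.2) (E4 p.1 p.2),
            b3 p.1 p.2, b4 p.1 p.2 hpT, b5 p.1 p.2]
      _ = _ := by simp
  calc _ ≤ (buyersLaw P D).real (S1 ∪ S2) := measureReal_mono hsub (measure_ne_top _ _)
    _ ≤ (buyersLaw P D).real S1 + (buyersLaw P D).real S2 := measureReal_union_le _ _
    _ ≤ d * (2 * Real.exp (-L)) + (d * T) * (4 * Real.exp (-L)) := add_le_add m1 m2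
    _ ≤ d * T * (2 * Real.exp (-L)) + (d * T) * (4 * Real.exp (-L)) := by
      gcongr
      nlinarith
    _ = 6 / T := by rw [hexp]; field_simp; norm_num

end Bounds

/-! ### Measurability of the interaction -/

section Measurability

/-- The observations whose entries are the rounds of `c`, `none` standing for no purchase. -/
def observe (x : ℕ → Review d) (c : List (Option ℕ)) : List (Obs d) := c.map (Option.map x)

/-- The rounds with a purchase among the first `t` rounds, most recent first, `none` standing for a
round without a purchase. -/
def purchases (τ : Thresholds d) (A : Pricing d) (x : ℕ → Review d) : ℕ → List (Option ℕ)
  | 0 => []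
  | t + 1 =>
    (if A (history τ A x t) ≤ τ (t + 1) (history τ A x t).reduceOption (x (t + 1)).1
      then some (t + 1) else none) :: purchases τ A x t

/-- This separates the countable data, which rounds ended in a purchase, from the reading of fixed
coordinates of `x`. Measurability along the run then reduces to `ObsMeasurable` and the level sets
of `purchases`. -/
lemma history_eq_observe (τ : Thresholds d) (A : Pricing d) (x : ℕ → Review d) (t : ℕ) :
    history τ A x t = observe x (purchases τ A x t) := by
  induction t with
  | zero => rfl
  | succ t ih =>
    rw [history, purchases, observe, List.map_cons, ← observe, ← ih]
    split_ifs <;> rfl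

/-- A function of the observations is measurable in the sequence of buyers, whichever rounds are
observed. -/
def ObsMeasurable {α : Type*} [MeasurableSpace α] (F : List (Obs d) → α) : Prop :=
  ∀ c, Measurable fun x : ℕ → Review d => F (observe x c)

lemma measurable_of_countable_index {Ω ι α : Type*} [MeasurableSpace Ω] [MeasurableSpace α]
    [Countable ι] {N : Ω → ι} (hN : ∀ c, MeasurableSet {ω | N ω = c}) {G : ι → Ω → α}
    (hG : ∀ c, Measurable (G c)) : Measurable fun ω => G (N ω) ω := by
  intro s hs
  have : (fun ω => G (N ω) ω) ⁻¹' s = ⋃ c, {ω | N ω = c} ∩ G c ⁻¹' s := by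
    ext ω
    simp
  rw [this]
  exact MeasurableSet.iUnion fun c => (hN c).inter (hG c hs)

lemma measurable_thresholds_observe {τ : Thresholds d} (hτ : MeasurableThresholds τ) (t : ℕ)
    (i : Fin d) (c : List (Option ℕ)) :
    Measurable fun x : ℕ → Review d => τ t (observe x c).reduceOption i := by
  have : ∀ x : ℕ → Review d, (observe x c).reduceOption
      = List.ofFn fun k : Fin c.reduceOption.length => x (c.reduceOption.get k) := by
    intro x
    rw [observe, List.reduceOption_map]
    conv_lhs => rw [← List.ofFn_get c.reduceOption]
    rw [List.map_ofFn]
    rfl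
  simp only [this]
  exact (hτ t _ i).comp (measurable_pi_lambda _ fun k => measurable_pi_apply _)

lemma measurable_type_index {α : Type*} [MeasurableSpace α] {G : Fin d → (ℕ → Review d) → α}
    (hG : ∀ i, Measurable (G i)) (t : ℕ) : Measurable fun x => G (x t).1 x :=
  measurable_of_countable_index (N := fun x : ℕ → Review d => (x t).1)
    (fun i => (measurableSet_fst_eq i).preimage (measurable_pi_apply t)) hG

/-- By induction, the price and the threshold of the next round are measurable on each of the
countably many pieces on which the earlier purchases are fixed, so the next decision is measurable
as well. -/
lemma measurableSet_purchases_eq {τ : Thresholds d} {A : Pricing d} (hτ : MeasurableThresholds τ)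
    (hA : ObsMeasurable A) (t : ℕ) :
    ∀ c, MeasurableSet {x : ℕ → Review d | purchases τ A x t = c} := by
  induction t with
  | zero =>
    intro c
    by_cases hc : [] = c
    · simp [purchases, hc]
    · simp [purchases, hc]
  | succ t ih =>
    intro c
    have hp : Measurable fun x : ℕ → Review d => A (history τ A x t) := by
      simp only [history_eq_observe]
      exact measurable_of_countable_index ih hA
    have ht : Measurable fun x : ℕ → Review d =>
        τ (t + 1) (history τ A x t).reduceOption (x (t + 1)).1 := by
      refine measurable_type_index (G := fun i x => τ (t + 1) (history τ A x t).reduceOption i)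
        (fun i => ?_) (t + 1)
      simp only [history_eq_observe]
      exact measurable_of_countable_index ih
        (G := fun c x => τ (t + 1) (observe x c).reduceOption i)
        (measurable_thresholds_observe hτ (t + 1) i)
    have hB := measurableSet_le hp ht
    cases c with
    | nil => simp [purchases]
    | cons o c =>
      have : {x : ℕ → Review d | purchases τ A x (t + 1) = o :: c}
          = (if o = some (t + 1) then
              {x | A (history τ A x t) ≤ τ (t + 1) (history τ A x t).reduceOption (x (t + 1)).1}
            else if o = none then
              {x | A (history τ A x t) ≤ τ (t + 1) (history τ A x t).reduceOption (x (t + 1)).1}ᶜ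
            else ∅) ∩ {x | purchases τ A x t = c} := by
        ext x
        simp only [purchases, List.cons.injEq, Set.mem_ofPred_eq, Set.mem_inter_iff]
        refine and_congr_left fun _ => ?_
        by_cases h : A (history τ A x t) ≤ τ (t + 1) (history τ A x t).reduceOption (x (t + 1)).1
        · rw [if_pos h]
          by_cases h1 : o = some (t + 1)
          · simp [h1, h]
          · by_cases h2 : o = none
            · simp [h2, h]
            · simp [h1, h2, Ne.symm h1]
        · rw [if_neg h]
          by_cases h1 : o = some (t + 1)
          · simp [h1, h]
          · by_cases h2 : o = none
            · simp [h2, h]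
            · simp [h1, h2, Ne.symm h2]
      rw [this]
      refine MeasurableSet.inter ?_ (ih c)
      split_ifs
      · exact hB
      · exact hB.compl
      · exact MeasurableSet.empty

lemma ObsMeasurable.comp_history {α : Type*} [MeasurableSpace α] {F : List (Obs d) → α}
    (hF : ObsMeasurable F) {τ : Thresholds d} {A : Pricing d} (hτ : MeasurableThresholds τ)
    (hA : ObsMeasurable A) (t : ℕ) :
    Measurable fun x : ℕ → Review d => F (history τ A x t) := by
  simp only [history_eq_observe]
  exact measurable_of_countable_index (measurableSet_purchases_eq hτ hA t) hF

lemma measurable_price {τ : Thresholds d} {A : Pricing d} (hτ : MeasurableThresholds τ)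
    (hA : ObsMeasurable A) (t : ℕ) : Measurable fun x => price τ A x t :=
  hA.comp_history hτ hA (t - 1)

lemma measurable_bought {τ : Thresholds d} {A : Pricing d} (hτ : MeasurableThresholds τ)
    (hA : ObsMeasurable A) (t : ℕ) : Measurable fun x => bought τ A x t := by
  refine Measurable.ite (measurableSet_le (measurable_price hτ hA t) ?_) measurable_const
    measurable_const
  exact measurable_type_index
    (G := fun i x => τ t (history τ A x (t - 1)).reduceOption i)
    (fun i => ObsMeasurable.comp_history (F := fun h => τ t h.reduceOption i)
      (measurable_thresholds_observe hτ t i) hτ hA (t - 1)) t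

lemma dependsOn_history (τ : Thresholds d) (A : Pricing d) (t : ℕ) :
    DependsOn (fun x => history τ A x t) (Finset.Icc 1 t) := by
  induction t with
  | zero => intro x y _; rfl
  | succ t ih =>
    intro x y h
    have h1 : history τ A x t = history τ A y t := ih fun i hi => h i (by
      simp only [Finset.coe_Icc, Set.mem_Icc] at hi ⊢
      omega)
    have h2 : x (t + 1) = y (t + 1) := h (t + 1) (by simp)
    simp only [history, h1, h2]

end Measurability

/-! ### Measurability of the algorithm -/

section Algorithm

/-- An observation without the reported value. -/
def forgetValue : Obs d → Obs d := Option.map fun r => (r.1, 0)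

lemma reduceOption_forget (h : List (Obs d)) :
    (h.map forgetValue).reduceOption = h.reduceOption.map fun r => (r.1, 0) :=
  List.reduceOption_map

lemma commonTypes_forget (lam : ℝ) (n : ℕ) (h : List (Obs d)) :
    commonTypes lam n (h.map forgetValue) = commonTypes lam n h := by
  unfold commonTypes firstRounds
  refine Finset.filter_congr fun i _ => ?_
  rw [List.length_map, ← List.map_drop, reduceOption_forget, List.countP_map]
  rfl

lemma revEstimate_forget (θ : Fin d → ℝ) (lam : ℝ) (n : ℕ) (h : List (Obs d)) (i : Fin d) :
    revEstimate θ lam n (h.map forgetValue) i = revEstimate θ lam n h i := by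
  unfold revEstimate laterRounds
  rw [commonTypes_forget, List.length_map, ← List.map_take, reduceOption_forget, List.countP_map]
  rfl

lemma plausible_forget (T : ℕ) (θ : Fin d → ℝ) (lam : ℝ) (n : ℕ) (h : List (Obs d))
    (S : Finset (Fin d)) :
    plausible T θ lam n (h.map forgetValue) S = plausible T θ lam n h S := by
  unfold plausible radius
  simp only [revEstimate_forget, List.length_map]

lemma activeTypes_forget (T : ℕ) (θ : Fin d → ℝ) (lam : ℝ) (n : ℕ) (h : List (Obs d)) :
    activeTypes T θ lam n (h.map forgetValue) = activeTypes T θ lam n h := by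
  induction h with
  | nil => rfl
  | cons o h ih =>
    have e := plausible_forget T θ lam n (o :: h) (activeTypes T θ lam n h)
    have e2 := commonTypes_forget lam n (o :: h)
    rw [List.map_cons] at e e2 ⊢
    rw [activeTypes, activeTypes, ih, e, e2]
    simp only [List.length_cons, List.length_map]

lemma measurableSet_types_eq (c : List (Option ℕ)) : ∀ l : List (Option (Fin d)),
    MeasurableSet {x : ℕ → Review d | c.map (Option.map fun s => (x s).1) = l} := by
  induction c with
  | nil =>
    intro l
    by_cases hl : [] = l <;> simp [hl]
  | cons o c ih =>
    intro l
    cases l with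
    | nil => simp
    | cons a l =>
      have : {x : ℕ → Review d | (o :: c).map (Option.map fun s => (x s).1) = a :: l}
          = {x | Option.map (fun s => (x s).1) o = a}
            ∩ {x | c.map (Option.map fun s => (x s).1) = l} := by
        ext x
        simp
      rw [this]
      refine MeasurableSet.inter ?_ (ih l)
      cases o with
      | none => by_cases ha : none = a <;> simp [ha]
      | some s =>
        cases a with
        | none => simp
        | some i =>
          have : {x : ℕ → Review d | Option.map (fun s => (x s).1) (some s) = some i}
              = (fun x => x s) ⁻¹' {r | r.1 = i} := by ext x; simp
          rw [this]
          exact (measurable_pi_apply s) (measurableSet_fst_eq i)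

/-- The active set ignores the reported values, so they may be replaced by `0`. It then depends on a
list of types only, which ranges over a countable set, and the recursion need not be followed. -/
lemma measurableSet_activeTypes_observe_eq (T : ℕ) (θ : Fin d → ℝ) (lam : ℝ) (n : ℕ)
    (c : List (Option ℕ)) (S : Finset (Fin d)) :
    MeasurableSet {x : ℕ → Review d | activeTypes T θ lam n (observe x c) = S} := by
  have : ∀ x : ℕ → Review d, activeTypes T θ lam n (observe x c)
      = activeTypes T θ lam n ((c.map (Option.map fun s => (x s).1)).map
          (Option.map fun i => (i, 0))) := by
    intro x
    rw [← activeTypes_forget, observe]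
    congr 1
    simp only [List.map_map]
    congr 1
    funext o
    cases o <;> rfl
  simp only [this]
  have h := measurable_of_countable_index (measurableSet_types_eq (d := d) c)
    (G := fun l _ => activeTypes T θ lam n (l.map (Option.map fun i => (i, 0))) = S)
    (fun l => measurable_const)
  exact measurableSet_setOfPred.2 h

lemma sum_valuesOf (σ : List (Review d)) (i : Fin d) :
    (valuesOf σ i).sum = (σ.map fun r => if r.1 = i then (r.2 : ℝ) else 0).sum := by
  induction σ with
  | nil => rfl
  | cons r σ ih =>
    unfold valuesOf at ih ⊢
    by_cases h : r.1 = i <;> simp [h, ih]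

lemma length_valuesOf (σ : List (Review d)) (i : Fin d) :
    ((valuesOf σ i).length : ℝ) = (σ.map fun r => if r.1 = i then (1 : ℝ) else 0).sum := by
  induction σ with
  | nil => simp [valuesOf]
  | cons r σ ih =>
    unfold valuesOf at ih ⊢
    rw [List.length_map] at ih ⊢
    by_cases h : r.1 = i
    · simp [h, ih, add_comm]
    · simp [h, ih]

/-- Sums over reviews are visibly measurable, and along a run they become sums over rounds by
`sum_map_history`. -/
lemma lowerConf_eq (η : ℝ) (m : ℕ) (σ : List (Review d)) (i : Fin d) :
    lowerConf η m σ i =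
      if (σ.map fun r => if r.1 = i then (1 : ℝ) else 0).sum = 0 then 0
      else max 0 ((σ.map fun r => if r.1 = i then (r.2 : ℝ) else 0).sum
        / (σ.map fun r => if r.1 = i then (1 : ℝ) else 0).sum
        - √(1 / (2 * (σ.map fun r => if r.1 = i then (1 : ℝ) else 0).sum) * Real.log (m / η))) := by
  rw [← sum_valuesOf, ← length_valuesOf, lowerConf]
  simp only [Nat.cast_eq_zero, List.length_eq_zero_iff]

lemma measurable_sum_map_observe {f : Review d → ℝ} (hf : Measurable f) (c : List (Option ℕ)) :
    Measurable fun x : ℕ → Review d => ((observe x c).reduceOption.map f).sum := by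
  simp only [observe, List.reduceOption_map, List.map_map]
  induction c.reduceOption with
  | nil => simp
  | cons s σ ih =>
    simp only [List.map_cons, List.sum_cons]
    exact (hf.comp (measurable_pi_apply s)).add ih

lemma obsMeasurable_lowerConf (η : ℝ) (m : ℕ) (i : Fin d) :
    ObsMeasurable fun h : List (Obs d) => lowerConf η m h.reduceOption i := by
  intro c
  simp only [lowerConf_eq]
  have h1 := measurable_sum_map_observe (f := fun r : Review d => if r.1 = i then (1 : ℝ) else 0)
    (Measurable.ite (measurableSet_fst_eq i) measurable_const measurable_const) c
  have h2 := measurable_sum_map_observe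
    (f := fun r : Review d => if r.1 = i then (r.2 : ℝ) else 0)
    (Measurable.ite (measurableSet_fst_eq i) (by fun_prop) measurable_const) c
  refine Measurable.ite (measurableSet_eq_fun h1 measurable_const) measurable_const ?_
  refine measurable_const.max ((h2.div h1).sub ?_)
  exact (((h1.const_mul 2).const_div 1).mul_const _).sqrt

lemma obsMeasurable_activePrice (T : ℕ) (η : ℝ) (θ : Fin d → ℝ) (S : Finset (Fin d)) :
    ObsMeasurable fun h : List (Obs d) => activePrice T η θ h.reduceOption S := by
  intro c
  unfold activePrice
  by_cases hS : S.Nonempty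
  · simp only [hS, dite_true]
    have h : Measurable (S.inf' hS fun i (x : ℕ → Review d) =>
        min (θ i) (lowerConf η T (observe x c).reduceOption i)) :=
      Finset.inf'_induction hS _ (fun _ h₁ _ h₂ => h₁.inf h₂)
        fun i _ => measurable_const.min (obsMeasurable_lowerConf η T i c)
    convert! h using 1
    funext x
    simp only [Finset.inf'_apply]
  · simp only [hS, dite_false]
    exact measurable_const

lemma obsMeasurable_onlinePricing (T : ℕ) (η : ℝ) (θ : Fin d → ℝ) (lam : ℝ) :
    ObsMeasurable (onlinePricing T η θ lam) := by
  intro c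
  unfold onlinePricing
  have hl : ∀ x : ℕ → Review d, (observe x c).length = c.length := fun x => List.length_map _
  simp only [hl]
  split_ifs
  · exact measurable_const
  · exact measurable_of_countable_index
      (measurableSet_activeTypes_observe_eq T θ lam (phaseOne d T lam) c)
      (G := fun S x => activePrice T η θ (observe x c).reduceOption S)
      (fun S => obsMeasurable_activePrice T η θ S c)

end Algorithm

/-! ### Histories as sums over rounds -/

section History

variable (τ : Thresholds d) (A : Pricing d) (x : ℕ → Review d)

/-- The buyer of round `t` purchases. -/
def Buys (t : ℕ) : Prop := price τ A x t ≤ τ t (history τ A x (t - 1)).reduceOption (x t).1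

lemma length_history (t : ℕ) : (history τ A x t).length = t := by
  induction t with
  | zero => rfl
  | succ t ih => rw [history, List.length_cons, ih]

open Classical in
lemma history_succ (t : ℕ) : history τ A x (t + 1) =
    (if Buys τ A x (t + 1) then some (x (t + 1)) else none) :: history τ A x t := by
  rw [history]
  by_cases h : Buys τ A x (t + 1)
  · rw [if_pos h]
    exact congrArg (· :: _) (if_pos h)
  · rw [if_neg h]
    exact congrArg (· :: _) (if_neg h)

lemma drop_history {n t : ℕ} (h : n ≤ t) : (history τ A x t).drop (t - n) = history τ A x n := by
  induction t, h using Nat.le_induction with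
  | base => simp
  | succ t ht ih => rw [Nat.succ_sub ht, history_succ, List.drop_succ_cons, ih]

open Classical in
lemma sum_map_take_history (f : Review d → ℝ) {n t : ℕ} (h : n ≤ t) :
    (((history τ A x t).take (t - n)).reduceOption.map f).sum
      = ∑ s ∈ Finset.Ioc n t, if Buys τ A x s then f (x s) else 0 := by
  induction t, h using Nat.le_induction with
  | base => simp
  | succ t ht ih =>
    rw [Nat.succ_sub ht, history_succ, List.take_succ_cons, ← Finset.insert_Ioc_right_eq_Ioc_add_one ht,
      Finset.sum_insert (by simp), ← ih]
    split_ifs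
    · rw [List.reduceOption_cons_of_some, List.map_cons, List.sum_cons]
    · rw [List.reduceOption_cons_of_none, zero_add]

open Classical in
lemma sum_map_history (f : Review d → ℝ) (t : ℕ) :
    ((history τ A x t).reduceOption.map f).sum
      = ∑ s ∈ Finset.Icc 1 t, if Buys τ A x s then f (x s) else 0 := by
  have h := sum_map_take_history τ A x f (Nat.zero_le t)
  have h2 : (history τ A x t).take (t - 0) = history τ A x t :=
    List.take_of_length_le (by rw [length_history]; simp)
  rw [h2] at h
  exact h

lemma countP_eq_sum_map {α : Type*} (p : α → Bool) (l : List α) :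
    (l.countP p : ℝ) = (l.map fun a => if p a then (1 : ℝ) else 0).sum := by
  induction l with
  | nil => simp
  | cons a l ih =>
    by_cases h : p a
    · simp [h, ih, add_comm]
    · simp [h, ih]

lemma bought_of_buys {t : ℕ} (h : Buys τ A x t) : bought τ A x t = 1 := if_pos h

lemma bought_nonneg (t : ℕ) : 0 ≤ bought τ A x t := by
  unfold bought
  split_ifs <;> norm_num

lemma bought_le_one (t : ℕ) : bought τ A x t ≤ 1 := by
  unfold bought
  split_ifs <;> norm_num

end History

/-! ### Confidence bounds and prices -/

section Prices

lemma lowerConf_nonneg (η : ℝ) (m : ℕ) (σ : List (Review d)) (i : Fin d) :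
    0 ≤ lowerConf η m σ i := by
  unfold lowerConf
  split_ifs
  · exact le_rfl
  · exact le_max_left _ _

/-- A larger `m` widens the confidence term. The seller's bound, with `m = T`, is thus below that of
the buyer in any round up to `T`. -/
lemma lowerConf_anti {η : ℝ} (hη : 0 < η) {m m' : ℕ} (hm : 1 ≤ m) (h : m ≤ m')
    (σ : List (Review d)) (i : Fin d) : lowerConf η m' σ i ≤ lowerConf η m σ i := by
  unfold lowerConf
  split_ifs
  · exact le_rfl
  · have : (0 : ℝ) < m := by exact_mod_cast hm
    gcongr

lemma activePrice_le {T : ℕ} {η : ℝ} {θ : Fin d → ℝ} {σ : List (Review d)} {S : Finset (Fin d)}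
    {i : Fin d} (hi : i ∈ S) : activePrice T η θ σ S ≤ min (θ i) (lowerConf η T σ i) := by
  unfold activePrice
  rw [dif_pos ⟨i, hi⟩]
  exact Finset.inf'_le _ hi

lemma activePrice_nonneg {T : ℕ} {η : ℝ} {θ : Fin d → ℝ} (hθ : ∀ i, 0 ≤ θ i)
    {σ : List (Review d)} {S : Finset (Fin d)} : 0 ≤ activePrice T η θ σ S := by
  unfold activePrice
  split_ifs with h
  · exact Finset.le_inf' _ _ fun i _ => le_min (hθ i) (lowerConf_nonneg _ _ _ _)
  · exact le_rfl

lemma activePrice_le_one {T : ℕ} {η : ℝ} {θ : Fin d → ℝ} (hθ : ∀ i, θ i ≤ 1)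
    {σ : List (Review d)} {S : Finset (Fin d)} : activePrice T η θ σ S ≤ 1 := by
  by_cases h : S.Nonempty
  · obtain ⟨i, hi⟩ := h
    exact (activePrice_le hi).trans ((min_le_left _ _).trans (hθ i))
  · unfold activePrice
    rw [dif_neg h]
    norm_num

lemma onlinePricing_nonneg {T : ℕ} {η lam : ℝ} {θ : Fin d → ℝ} (hθ : ∀ i, 0 ≤ θ i)
    (h : List (Obs d)) : 0 ≤ onlinePricing T η θ lam h := by
  unfold onlinePricing
  split_ifs
  · exact le_rfl
  · exact activePrice_nonneg hθ

lemma onlinePricing_le_one {T : ℕ} {η lam : ℝ} {θ : Fin d → ℝ} (hθ : ∀ i, θ i ≤ 1)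
    (h : List (Obs d)) : onlinePricing T η θ lam h ≤ 1 := by
  unfold onlinePricing
  split_ifs
  · norm_num
  · exact activePrice_le_one hθ

end Prices

/-! ### Active types and uncensored estimates -/

section ActiveTypes

lemma activeTypes_of_length_le {T : ℕ} {θ : Fin d → ℝ} {lam : ℝ} {n : ℕ} {h : List (Obs d)}
    (hn : h.length ≤ n) : activeTypes T θ lam n h = commonTypes lam n h := by
  cases h with
  | nil => rfl
  | cons o h => rw [activeTypes, if_pos hn]

lemma plausible_subset (T : ℕ) (θ : Fin d → ℝ) (lam : ℝ) (n : ℕ) (h : List (Obs d))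
    (S : Finset (Fin d)) : plausible T θ lam n h S ⊆ S := Finset.filter_subset _ _

/-- The estimate sees a type only through `θ`. This handles ties: elimination compares indices,
upward closure compares ex-ante values. -/
lemma mem_plausible_of_eq {T : ℕ} {θ : Fin d → ℝ} {lam : ℝ} {n : ℕ} {h : List (Obs d)}
    {S : Finset (Fin d)} {i k : Fin d} (hk : k ∈ S) (hik : θ i = θ k)
    (hi : i ∈ plausible T θ lam n h S) : k ∈ plausible T θ lam n h S := by
  have : revEstimate θ lam n h k = revEstimate θ lam n h i := by
    unfold revEstimate
    rw [hik]
  rw [plausible, Finset.mem_filter] at hi ⊢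
  exact ⟨hk, by rw [this]; exact hi.2⟩

lemma exists_mem_le_of_min_le {S : Finset (Fin d)} {j : Fin d} (h : S.min ≤ (j : WithTop (Fin d))) :
    ∃ m ∈ S, m ≤ j := by
  have hne : S.Nonempty := by
    by_contra hS
    rw [Finset.not_nonempty_iff_eq_empty] at hS
    simp [hS] at h
  obtain ⟨m, hm⟩ := Finset.min_of_nonempty hne
  refine ⟨m, Finset.mem_of_min hm, ?_⟩
  rw [hm] at h
  exact WithTop.coe_le_coe.1 h

variable {τ : Thresholds d} {T : ℕ} {η lam : ℝ} {θ : Fin d → ℝ} {x : ℕ → Review d}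

/-- The active types in round `t + 1` of a run of the two-phase algorithm. -/
abbrev activeAfter (τ : Thresholds d) (T : ℕ) (η lam : ℝ) (θ : Fin d → ℝ) (x : ℕ → Review d)
    (t : ℕ) : Finset (Fin d) :=
  activeTypes T θ lam (phaseOne d T lam) (history τ (onlinePricing T η θ lam) x t)

lemma price_eq_zero {t : ℕ} (ht : t < phaseOne d T lam) :
    price τ (onlinePricing T η θ lam) x (t + 1) = 0 := by
  rw [price, onlinePricing, length_history, Nat.add_sub_cancel, if_pos ht]

lemma price_eq_activePrice {t : ℕ} (ht : phaseOne d T lam ≤ t) :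
    price τ (onlinePricing T η θ lam) x (t + 1) =
      activePrice T η θ (history τ (onlinePricing T η θ lam) x t).reduceOption
        (activeAfter τ T η lam θ x t) := by
  rw [price, onlinePricing, length_history, Nat.add_sub_cancel, if_neg (not_lt.2 ht)]

lemma lowerConf_le_threshold (hη : 0 < η) (hτ : Pessimistic η T τ) (A : Pricing d) {t : ℕ}
    (ht : t < T) (i : Fin d) :
    lowerConf η T (history τ A x t).reduceOption i
      ≤ τ (t + 1) (history τ A x t).reduceOption i := by
  refine (lowerConf_anti hη (Nat.le_add_left 1 t) ht _ _).trans (hτ (t + 1) (by omega) ht _ ?_ i)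
  exact Nat.lt_succ_of_le ((List.reduceOption_length_le _).trans (length_history τ A x t).le)

lemma buys_of_lt_phaseOne (hη : 0 < η) (hτ : Pessimistic η T τ) {t : ℕ} (ht : t < T)
    (htn : t < phaseOne d T lam) : Buys τ (onlinePricing T η θ lam) x (t + 1) := by
  rw [Buys, price_eq_zero htn]
  exact (lowerConf_nonneg _ _ _ _).trans (lowerConf_le_threshold hη hτ _ ht _)

lemma buys_of_mem_active (hη : 0 < η) (hτ : Pessimistic η T τ) {t : ℕ} (ht : t < T)
    (htn : phaseOne d T lam ≤ t) (hmem : (x (t + 1)).1 ∈ activeAfter τ T η lam θ x t) :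
    Buys τ (onlinePricing T η θ lam) x (t + 1) := by
  rw [Buys, price_eq_activePrice htn]
  exact (activePrice_le hmem).trans
    ((min_le_right _ _).trans (lowerConf_le_threshold hη hτ _ ht _))

/-- At price `0` every buyer purchases, so the reviews of the first phase show all arrivals. -/
lemma commonTypes_history_eq (hη : 0 < η) (hτ : Pessimistic η T τ) (hn : phaseOne d T lam ≤ T)
    {t : ℕ} (ht : phaseOne d T lam ≤ t) :
    commonTypes lam (phaseOne d T lam) (history τ (onlinePricing T η θ lam) x t)
      = frequentTypes lam (phaseOne d T lam) x := by
  classical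
  unfold commonTypes frequentTypes
  refine Finset.filter_congr fun i _ => ?_
  rw [firstRounds, length_history, drop_history _ _ _ ht, countP_eq_sum_map, sum_map_history]
  suffices h : (∑ s ∈ Finset.Icc 1 (phaseOne d T lam),
      if Buys τ (onlinePricing T η θ lam) x s then
        (if decide ((x s).1 = i) = true then (1 : ℝ) else 0) else 0)
      = arrivals i (phaseOne d T lam) x by rw [h]
  unfold arrivals hits
  refine Finset.sum_congr rfl fun s hs => ?_
  rw [Finset.mem_Icc] at hs
  obtain ⟨u, rfl⟩ : ∃ u, s = u + 1 := ⟨s - 1, by omega⟩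
  rw [if_pos (buys_of_lt_phaseOne hη hτ (by omega) (by omega)), Set.indicator_apply]
  simp

lemma activeAfter_phaseOne (hη : 0 < η) (hτ : Pessimistic η T τ) (hn : phaseOne d T lam ≤ T) :
    activeAfter τ T η lam θ x (phaseOne d T lam) = frequentTypes lam (phaseOne d T lam) x := by
  rw [activeAfter, activeTypes_of_length_le (length_history _ _ _ _).le,
    commonTypes_history_eq hη hτ hn le_rfl]

lemma mem_activeAfter_succ {t : ℕ} (ht : phaseOne d T lam ≤ t) {j : Fin d} :
    j ∈ activeAfter τ T η lam θ x (t + 1) ↔ j ∈ activeAfter τ T η lam θ x t ∧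
      (plausible T θ lam (phaseOne d T lam) (history τ (onlinePricing T η θ lam) x (t + 1))
        (activeAfter τ T η lam θ x t)).min ≤ (j : WithTop (Fin d)) := by
  have hlen : ¬ (history τ (onlinePricing T η θ lam) x (t + 1)).length ≤ phaseOne d T lam := by
    rw [length_history]
    omega
  unfold activeAfter
  rw [history_succ] at hlen ⊢
  rw [activeTypes, if_neg hlen, Finset.mem_filter]

lemma activeAfter_anti {s t : ℕ} (hs : phaseOne d T lam ≤ s) (hst : s ≤ t) :
    activeAfter τ T η lam θ x t ⊆ activeAfter τ T η lam θ x s := by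
  induction t, hst using Nat.le_induction with
  | base => exact Finset.Subset.refl _
  | succ t ht ih =>
    exact fun j hj => ih ((mem_activeAfter_succ (hs.trans ht)).1 hj).1

lemma activeAfter_subset (hη : 0 < η) (hτ : Pessimistic η T τ) (hn : phaseOne d T lam ≤ T) {t : ℕ}
    (ht : phaseOne d T lam ≤ t) :
    activeAfter τ T η lam θ x t ⊆ frequentTypes lam (phaseOne d T lam) x := by
  rw [← activeAfter_phaseOne hη hτ hn (θ := θ)]
  exact activeAfter_anti le_rfl ht

/-- The set of active types is closed upwards in `Q` with respect to the ex-ante values. -/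
lemma mem_activeAfter_of_le (hθ : Monotone θ) (hη : 0 < η) (hτ : Pessimistic η T τ)
    (hn : phaseOne d T lam ≤ T) {t : ℕ} (ht : phaseOne d T lam ≤ t) :
    ∀ i k, i ∈ activeAfter τ T η lam θ x t → k ∈ frequentTypes lam (phaseOne d T lam) x →
      θ i ≤ θ k → k ∈ activeAfter τ T η lam θ x t := by
  induction t, ht using Nat.le_induction with
  | base =>
    intro i k _ hk _
    rw [activeAfter_phaseOne hη hτ hn]
    exact hk
  | succ t ht ih =>
    intro i k hi hk hik
    rw [mem_activeAfter_succ ht] at hi ⊢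
    have hkS := ih i k hi.1 hk hik
    refine ⟨hkS, ?_⟩
    obtain ⟨m, hm, hmi⟩ := exists_mem_le_of_min_le hi.2
    by_cases hmk : m ≤ k
    · exact (Finset.min_le hm).trans (WithTop.coe_le_coe.2 hmk)
    -- If `k < m`, then `θ m ≤ θ i ≤ θ k ≤ θ m`, so `k` ties with `m` and is plausible itself.
    · refine Finset.min_le (mem_plausible_of_eq hkS ?_ hm)
      exact le_antisymm ((hθ hmi).trans hik) (hθ (not_le.1 hmk).le)

/-- A type that is active after round `t` purchases in all earlier rounds in which it arrives. -/
lemma buys_of_active_later (hη : 0 < η) (hτ : Pessimistic η T τ) {s t : ℕ} (hs : 1 ≤ s)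
    (hst : s ≤ t + 1) (ht : t < T)
    (hmem : (x s).1 ∈ activeAfter τ T η lam θ x t) : Buys τ (onlinePricing T η θ lam) x s := by
  obtain ⟨u, rfl⟩ : ∃ u, s = u + 1 := ⟨s - 1, by omega⟩
  by_cases hu : u < phaseOne d T lam
  · exact buys_of_lt_phaseOne hη hτ (by omega) hu
  · exact buys_of_mem_active hη hτ (by omega) (not_lt.1 hu)
      (activeAfter_anti (not_lt.1 hu) (by omega) hmem)

/-- Every type counted lies in `Q` above the active type `i`, hence is active by upward closure,
hence purchased whenever it arrived. The purchase indicator in the estimate is therefore redundant.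
-/
lemma revEstimate_history_eq (hθ : Monotone θ) (hη : 0 < η) (hτ : Pessimistic η T τ) {t : ℕ}
    (ht : t < T) (htn : phaseOne d T lam ≤ t) {i : Fin d}
    (hi : i ∈ activeAfter τ T η lam θ x t) :
    revEstimate θ lam (phaseOne d T lam) (history τ (onlinePricing T η θ lam) x (t + 1)) i
      = θ i * hits {r | r.1 ∈ above θ (frequentTypes lam (phaseOne d T lam) x) i}
          (Finset.Ioc (phaseOne d T lam) (t + 1)) x
        / (Finset.Ioc (phaseOne d T lam) (t + 1)).card := by
  classical
  have hn : phaseOne d T lam ≤ T := htn.trans ht.le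
  have htn' : phaseOne d T lam ≤ t + 1 := by omega
  rw [revEstimate, commonTypes_history_eq hη hτ hn htn', laterRounds, length_history,
    countP_eq_sum_map, sum_map_take_history _ _ _ _ htn', Nat.card_Ioc, Nat.cast_sub htn']
  congr 2
  unfold hits
  refine Finset.sum_congr rfl fun s hs => ?_
  rw [Finset.mem_Ioc] at hs
  rw [Set.indicator_apply]
  by_cases h : (x s).1 ∈ above θ (frequentTypes lam (phaseOne d T lam) x) i
  · have h' := h
    rw [above, Finset.mem_filter] at h'
    have hb := buys_of_active_later hη hτ (by omega) hs.2 ht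
      (mem_activeAfter_of_le hθ hη hτ hn htn i _ hi h'.1 h'.2)
    rw [if_pos hb]
    simp [h, h'.1, h'.2]
  · have h' := h
    rw [above, Finset.mem_filter] at h'
    have h2 : ¬ (θ i ≤ θ (x s).1 ∧ (x s).1 ∈ frequentTypes lam (phaseOne d T lam) x) :=
      fun hc => h' ⟨hc.2, hc.1⟩
    simp only [Set.mem_ofPred_eq, h, if_false, decide_eq_true_eq, h2, ite_self]

end ActiveTypes

/-- The revenue per round of the price `θ i` if only the types of `Q` purchase. -/
def revenueOn (P : PMF (Fin d)) (θ : Fin d → ℝ) (Q : Finset (Fin d)) (i : Fin d) : ℝ :=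
  θ i * mass P (above θ Q i)

/-- The confidence radius of the revenue estimates after `m` rounds of the second phase. -/
def rho (d T : ℕ) (m : ℝ) : ℝ := √(Real.log (d * (T : ℝ) ^ 2) / (2 * m))

/-- The types of probability below `lam`. -/
def rareTypes (P : PMF (Fin d)) (lam : ℝ) : Finset (Fin d) := {i | (P i).toReal < lam}

/-! ### Reducing the optimal price to the ex-ante values in `Q` -/

section OptimalRevenue

lemma optimalRevenue_le_one (P : PMF (Fin d)) (θ : Fin d → ℝ) : optimalRevenue P θ ≤ 1 := by
  refine ciSup_le fun p => ?_
  exact mul_le_one₀ p.2.2 measureReal_nonneg measureReal_le_one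

/-- Up to the mass of the rare types, the optimal revenue is attained at the ex-ante value of a
type of `Q`. -/
lemma optimalRevenue_le (P : PMF (Fin d)) {θ : Fin d → ℝ} (hθ : Monotone θ)
    {Q : Finset (Fin d)} {lam B : ℝ} (hQ : ∀ i, lam ≤ (P i).toReal → i ∈ Q) (hB0 : 0 ≤ B)
    (hB : ∀ i ∈ Q, revenueOn P θ Q i ≤ B) :
    optimalRevenue P θ ≤ B + mass P (rareTypes P lam) := by
  classical
  refine ciSup_le fun p => ?_
  set Sp : Finset (Fin d) := {i | (p : ℝ) ≤ θ i} with hSp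
  have h1 : P.toMeasure.real {i | (p : ℝ) ≤ θ i} = mass P Sp := by
    rw [← toMeasure_real_eq_mass]
    simp [hSp]
  rw [h1]
  have h2 : mass P Sp ≤ mass P (Sp ∩ Q) + mass P (rareTypes P lam) := by
    have h3 : Sp ⊆ (Sp ∩ Q) ∪ rareTypes P lam := by
      intro i hi
      rw [Finset.mem_union, Finset.mem_inter]
      by_cases h : (P i).toReal < lam
      · exact Or.inr (Finset.mem_filter.2 ⟨Finset.mem_univ _, h⟩)
      · exact Or.inl ⟨hi, hQ i (not_lt.1 h)⟩
    refine (mass_mono P h3).trans ?_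
    have := Finset.sum_union_inter (s₁ := Sp ∩ Q) (s₂ := rareTypes P lam)
      (f := fun j => (P j).toReal)
    have h0 := mass_nonneg P ((Sp ∩ Q) ∩ rareTypes P lam)
    unfold mass at *
    linarith
  have h4 : (p : ℝ) * mass P (Sp ∩ Q) ≤ B := by
    by_cases hne : (Sp ∩ Q).Nonempty
    -- Raising the price from `p` to the value of the lowest type of `Q` that accepts `p` loses no
    -- buyer of `Q`.
    · set k := (Sp ∩ Q).min' hne
      have hk : k ∈ Sp ∩ Q := Finset.min'_mem _ _
      rw [Finset.mem_inter, hSp, Finset.mem_filter] at hk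
      refine le_trans ?_ (hB k hk.2)
      have hsub : Sp ∩ Q ⊆ above θ Q k := by
        intro j hj
        rw [above, Finset.mem_filter]
        exact ⟨(Finset.mem_inter.1 hj).2, hθ (Finset.min'_le _ _ hj)⟩
      exact mul_le_mul hk.1.2 (mass_mono P hsub) (mass_nonneg _ _) (p.2.1.trans hk.1.2)
    · rw [Finset.not_nonempty_iff_eq_empty] at hne
      simpa [hne, mass] using hB0
  have h5 := mass_nonneg P (rareTypes P lam)
  nlinarith [mul_le_mul_of_nonneg_left h2 p.2.1, mul_le_mul_of_nonneg_right p.2.2 h5]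

end OptimalRevenue

/-! ### The run on a typical sequence -/

section TypicalRun

variable {τ : Thresholds d} {T : ℕ} {η lam : ℝ} {θ : Fin d → ℝ} {x : ℕ → Review d}
  {P : PMF (Fin d)}

lemma half_le_of_mem_frequentTypes {n : ℕ} (hn : 0 < n) (hx : Typical P θ lam n T x) {i : Fin d}
    (hi : i ∈ frequentTypes lam n x) : lam / 2 ≤ (P i).toReal := by
  by_contra h
  have h1 := hx.rare i (not_le.1 h)
  rw [frequentTypes, Finset.mem_filter, le_div_iff₀ (by exact_mod_cast hn)] at hi
  linarith [hi.2]

lemma mem_frequentTypes_of_le {n : ℕ} (hn : 0 < n) (hx : Typical P θ lam n T x) {i : Fin d}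
    (hi : lam ≤ (P i).toReal) : i ∈ frequentTypes lam n x := by
  rw [frequentTypes, Finset.mem_filter, le_div_iff₀ (by exact_mod_cast hn)]
  exact ⟨Finset.mem_univ _, hx.frequent i hi⟩

lemma abs_revEstimate_sub_le (hθ : Monotone θ) (hθ0 : ∀ i, 0 ≤ θ i) (hθ1 : ∀ i, θ i ≤ 1)
    (hη : 0 < η) (hτ : Pessimistic η T τ)
    (hx : Typical P θ lam (phaseOne d T lam) T x) {t : ℕ} (ht : t + 1 < T)
    (htn : phaseOne d T lam ≤ t) {i : Fin d} (hi : i ∈ activeAfter τ T η lam θ x t) :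
    |revEstimate θ lam (phaseOne d T lam) (history τ (onlinePricing T η θ lam) x (t + 1)) i
      - revenueOn P θ (frequentTypes lam (phaseOne d T lam) x) i|
      ≤ radius T (phaseOne d T lam) (history τ (onlinePricing T η θ lam) x (t + 1)) := by
  have h := hx.estimate i (t + 1) (by omega) ht
  rw [revEstimate_history_eq hθ hη hτ (by omega) htn hi, radius, length_history, revenueOn]
  have hcard : ((Finset.Ioc (phaseOne d T lam) (t + 1)).card : ℝ)
      = ((t + 1 : ℕ) : ℝ) - phaseOne d T lam := by
    rw [Nat.card_Ioc, Nat.cast_sub (by omega)]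
  have hpos : (0 : ℝ) < ((t + 1 : ℕ) : ℝ) - phaseOne d T lam := by
    rw [sub_pos]
    exact_mod_cast Nat.lt_succ_of_le htn
  rw [hcard] at h ⊢
  set c : ℝ := ((t + 1 : ℕ) : ℝ) - phaseOne d T lam
  set N := hits {r | r.1 ∈ above θ (frequentTypes lam (phaseOne d T lam) x) i}
    (Finset.Ioc (phaseOne d T lam) (t + 1)) x
  set M := mass P (above θ (frequentTypes lam (phaseOne d T lam) x) i)
  have e : θ i * N / c - θ i * M = θ i * ((N - c * M) / c) := by
    field_simp
  rw [e, abs_mul, abs_of_nonneg (hθ0 i), abs_div, abs_of_pos hpos]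
  have h2 : |N - c * M| / c ≤ √(Real.log (d * (T : ℝ) ^ 2) / (2 * c)) := by
    rw [div_le_iff₀ hpos, mul_comm _ c]
    exact h
  calc _ ≤ 1 * (|N - c * M| / c) := by
        gcongr
        exact hθ1 i
    _ ≤ _ := by rwa [one_mul]

/-- The best type of `Q` is never eliminated. -/
lemma best_mem_activeAfter (hθ : Monotone θ) (hθ0 : ∀ i, 0 ≤ θ i) (hθ1 : ∀ i, θ i ≤ 1)
    (hη : 0 < η) (hτ : Pessimistic η T τ)
    (hx : Typical P θ lam (phaseOne d T lam) T x) {b : Fin d}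
    (hb : b ∈ frequentTypes lam (phaseOne d T lam) x)
    (hbest : ∀ i ∈ frequentTypes lam (phaseOne d T lam) x,
      revenueOn P θ (frequentTypes lam (phaseOne d T lam) x) i
        ≤ revenueOn P θ (frequentTypes lam (phaseOne d T lam) x) b) {t : ℕ}
    (htn : phaseOne d T lam ≤ t) : t < T → b ∈ activeAfter τ T η lam θ x t := by
  induction t, htn using Nat.le_induction with
  | base =>
    intro ht
    rwa [activeAfter_phaseOne hη hτ ht.le]
  | succ t htn ih =>
    intro ht
    have hbS := ih (by omega)
    rw [mem_activeAfter_succ htn]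
    -- It suffices that `b` is plausible: its true revenue is at least that of `k`, and each
    -- estimate errs by at most one radius.
    refine ⟨hbS, Finset.min_le ?_⟩
    rw [plausible, Finset.mem_filter]
    refine ⟨hbS, fun k hk => ?_⟩
    have h1 := abs_le.1 (abs_revEstimate_sub_le hθ hθ0 hθ1 hη hτ hx ht htn hbS)
    have h2 := abs_le.1 (abs_revEstimate_sub_le hθ hθ0 hθ1 hη hτ hx ht htn hk)
    have h3 := hbest k (activeAfter_subset hη hτ (by omega) htn hk)
    linarith [h1.1, h2.2]

/-- The lower confidence bound of an active type is close to its ex-ante value. -/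
lemma le_lowerConf_of_active (hη : 0 < η) (hη1 : η ≤ 1) (hτ : Pessimistic η T τ) (hd : 1 ≤ d)
    (hx : Typical P θ lam (phaseOne d T lam) T x) (hn0 : 0 < phaseOne d T lam) {q₀ : ℝ}
    (hq₀ : 0 < q₀) (hq : ∀ i, lam / 2 ≤ (P i).toReal → q₀ ≤ (P i).toReal) {t : ℕ}
    (htn : phaseOne d T lam ≤ t) (ht : t < T) {i : Fin d}
    (hi : i ∈ activeAfter τ T η lam θ x t) :
    θ i - 3 * √(Real.log (d * T / η) / (t * q₀))
      ≤ lowerConf η T (history τ (onlinePricing T η θ lam) x t).reduceOption i := by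
  classical
  have hhalf := half_le_of_mem_frequentTypes hn0 hx (activeAfter_subset hη hτ (htn.trans ht.le) htn hi)
  have hN := hx.arrivals_ge i hhalf t htn ht
  have hV := hx.values_ge i t ht
  have htpos : (0 : ℝ) < t := by exact_mod_cast hn0.trans_le htn
  have hTpos : (1 : ℝ) ≤ T := by exact_mod_cast (by omega : 1 ≤ T)
  have hdpos : (1 : ℝ) ≤ d := by exact_mod_cast hd
  -- An active type purchased at all its arrivals, so its reviews are exactly its arrivals.
  have e : ∀ f : Review d → ℝ,
      ((history τ (onlinePricing T η θ lam) x t).reduceOption.map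
        fun r => if r.1 = i then f r else 0).sum
      = ∑ s ∈ Finset.Icc 1 t, if (x s).1 = i then f (x s) else 0 := by
    intro f
    rw [sum_map_history]
    refine Finset.sum_congr rfl fun s hs => ?_
    rw [Finset.mem_Icc] at hs
    by_cases hsi : (x s).1 = i
    · rw [if_pos (buys_of_active_later hη hτ hs.1 (by omega) ht (hsi ▸ hi))]
    · simp [hsi]
  have e1 : ∑ s ∈ Finset.Icc 1 t, (if (x s).1 = i then (1 : ℝ) else 0) = arrivals i t x := by
    unfold arrivals hits
    exact Finset.sum_congr rfl fun s _ => by simp [Set.indicator_apply]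
  rw [lowerConf_eq, e fun _ => 1, e fun r => (r.2 : ℝ), e1]
  change _ ≤ if arrivals i t x = 0 then 0 else max 0 (valueSum i t x / arrivals i t x -
    √(1 / (2 * arrivals i t x) * Real.log (T / η)))
  set N := arrivals i t x
  set V := valueSum i t x
  have hNq : t * q₀ / 2 ≤ N := by
    have : (t : ℝ) * q₀ ≤ t * (P i).toReal := by gcongr; exact hq i hhalf
    linarith
  have hNpos : 0 < N := lt_of_lt_of_le (by positivity) hNq
  rw [if_neg hNpos.ne']
  refine le_trans ?_ (le_max_right _ _)
  have hTη : 1 ≤ T / η := by rw [le_div_iff₀ hη]; linarith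
  have hlogT : Real.log (T / η) ≤ Real.log (d * T / η) := by
    refine Real.log_le_log (by positivity) ?_
    rw [mul_div_assoc]
    nlinarith
  have hlogT0 : 0 ≤ Real.log (T / η) := Real.log_nonneg hTη
  have hlogd : Real.log (d * T) ≤ Real.log (d * T / η) := by
    refine Real.log_le_log (by positivity) ?_
    rw [le_div_iff₀ hη]
    nlinarith [mul_pos (lt_of_lt_of_le one_pos hdpos) (lt_of_lt_of_le one_pos hTpos)]
  set Λ := Real.log (d * T / η)
  have hΛ : 0 ≤ Λ := hlogT0.trans hlogT
  -- Since `N ≥ t q₀/2`, the confidence term is at most `w` and the error of the empirical mean at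
  -- most `2w`, which gives the factor `3`.
  set w := √(Λ / (t * q₀))
  have hinv : 1 / (2 * N) ≤ 1 / (t * q₀) := by
    refine one_div_le_one_div_of_le (by positivity) (by linarith)
  have hw1 : √(1 / (2 * N) * Real.log (T / η)) ≤ w := by
    refine Real.sqrt_le_sqrt ?_
    calc _ ≤ 1 / (t * q₀) * Λ := by gcongr
      _ = _ := by ring
  have hw2 : √(N * (3 * Real.log (d * T)) / 2) ≤ N * (2 * w) := by
    refine Real.sqrt_le_iff.2 ⟨by positivity, ?_⟩
    have hw : w ^ 2 = Λ / (t * q₀) := Real.sq_sqrt (by positivity)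
    have h1 : 1 ≤ 2 * N * (1 / (t * q₀)) := by
      rw [mul_one_div, le_div_iff₀ (by positivity)]
      linarith
    calc N * (3 * Real.log (d * T)) / 2 ≤ N * (3 * Λ) / 2 := by gcongr
      _ ≤ 2 * N * Λ * 1 := by nlinarith [mul_nonneg hNpos.le hΛ]
      _ ≤ 2 * N * Λ * (2 * N * (1 / (t * q₀))) := by gcongr
      _ = (N * (2 * w)) ^ 2 := by rw [mul_pow, mul_pow, hw]; ring
  have hVN : θ i - 2 * w ≤ V / N := by
    rw [le_div_iff₀ hNpos]
    nlinarith
  linarith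

/-- On a typical sequence of buyers, every round of the second phase but the first one has
near-optimal expected revenue given the past. -/
lemma optimalRevenue_le_price_mul_mass (hθ : Monotone θ) (hθ0 : ∀ i, 0 ≤ θ i)
    (hθ1 : ∀ i, θ i ≤ 1) (hη : 0 < η) (hη1 : η ≤ 1) (hτ : Pessimistic η T τ) (hd : 1 ≤ d)
    (hx : Typical P θ lam (phaseOne d T lam) T x) (hn0 : 0 < phaseOne d T lam) {q₀ : ℝ}
    (hq₀ : 0 < q₀) (hq : ∀ i, lam / 2 ≤ (P i).toReal → q₀ ≤ (P i).toReal) {t : ℕ}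
    (htn : phaseOne d T lam < t) (ht : t < T) :
    optimalRevenue P θ - (mass P (rareTypes P lam) + 4 * rho d T (t - phaseOne d T lam)
        + 3 * √(Real.log (d * T / η) / (t * q₀)))
      ≤ price τ (onlinePricing T η θ lam) x (t + 1) * mass P (activeAfter τ T η lam θ x t) := by
  classical
  rw [price_eq_activePrice htn.le]
  set Q := frequentTypes lam (phaseOne d T lam) x with hQdef
  set S := activeAfter τ T η lam θ x t with hS
  set p := activePrice T η θ (history τ (onlinePricing T η θ lam) x t).reduceOption S
  set w := √(Real.log (d * T / η) / (t * q₀))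
  have hw0 : 0 ≤ w := Real.sqrt_nonneg _
  have hρ0 : 0 ≤ rho d T (t - phaseOne d T lam) := Real.sqrt_nonneg _
  have hp0 : 0 ≤ p := activePrice_nonneg hθ0
  have hQmem : ∀ i, lam ≤ (P i).toReal → i ∈ Q := fun i hi => mem_frequentTypes_of_le hn0 hx hi
  by_cases hQ : Q.Nonempty
  · obtain ⟨b, hbQ, hbest⟩ := Finset.exists_max_image Q (revenueOn P θ Q) hQ
    have hopt : _ ≤ revenueOn P θ Q b + _ := optimalRevenue_le P hθ hQmem
      (mul_nonneg (hθ0 b) (mass_nonneg _ _) : 0 ≤ revenueOn P θ Q b) hbest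
    have hbS : b ∈ S := best_mem_activeAfter hθ hθ0 hθ1 hη hτ hx hbQ hbest htn.le ht
    have hSne : S.Nonempty := ⟨b, hbS⟩
    set m := S.min' hSne with hm
    have hmS : m ∈ S := Finset.min'_mem _ _
    have hSsub : S ⊆ Q := activeAfter_subset hη hτ (htn.le.trans ht.le) htn.le
    -- By upward closure, so `revenueOn P θ Q m` is `θ m` times the mass of the types sure to
    -- purchase.
    have hSeq : S = above θ Q m := by
      ext j
      rw [above, Finset.mem_filter]
      exact ⟨fun hj => ⟨hSsub hj, hθ (Finset.min'_le _ _ hj)⟩,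
        fun hj => mem_activeAfter_of_le hθ hη hτ (htn.le.trans ht.le) htn.le m j hmS hj.1 hj.2⟩
    -- As `t` exceeds the first phase, an elimination has just taken place. Some plausible type is
    -- at most `m` and survives, so it is `m` itself. Of the four radii, two come from the
    -- plausibility test and two from the estimation errors.
    have hrev : revenueOn P θ Q b - 4 * rho d T (t - phaseOne d T lam) ≤ revenueOn P θ Q m := by
      obtain ⟨u, rfl⟩ : ∃ u, t = u + 1 := ⟨t - 1, by omega⟩
      have hun : phaseOne d T lam ≤ u := by omega
      have hmS' := (mem_activeAfter_succ hun).1 hmS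
      have hbS' := (mem_activeAfter_succ hun).1 hbS
      obtain ⟨m', hm', hmm'⟩ := exists_mem_le_of_min_le hmS'.2
      have hm'S : m' ∈ S :=
        (mem_activeAfter_succ hun).2 ⟨plausible_subset _ _ _ _ _ _ hm', Finset.min_le hm'⟩
      have hmeq : m' = m := le_antisymm hmm' (Finset.min'_le _ _ hm'S)
      rw [hmeq, plausible, Finset.mem_filter] at hm'
      have h0 := hm'.2 b hbS'.1
      have h1 := abs_le.1 (abs_revEstimate_sub_le hθ hθ0 hθ1 hη hτ hx ht hun hbS'.1)
      have h2 := abs_le.1 (abs_revEstimate_sub_le hθ hθ0 hθ1 hη hτ hx ht hun hmS'.1)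
      have hr : radius T (phaseOne d T lam) (history τ (onlinePricing T η θ lam) x (u + 1))
          = rho d T ((u + 1 : ℕ) - phaseOne d T lam) := by
        rw [radius, length_history, rho]
      rw [hr] at h0 h1 h2
      linarith [h1.1, h2.2]
    have hp : θ m - 3 * w ≤ p := by
      simp only [p, activePrice]
      rw [dif_pos hSne]
      refine Finset.le_inf' _ _ fun i hi => le_min ?_ ?_
      · have := hθ (Finset.min'_le _ _ hi : m ≤ i)
        linarith
      · have h1 := hθ (Finset.min'_le _ _ hi : m ≤ i)
        have h2 := le_lowerConf_of_active hη hη1 hτ hd hx hn0 hq₀ hq htn.le ht hi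
        linarith
    have hmass : mass P S ≤ 1 := mass_le_one P S
    have hmass0 : 0 ≤ mass P S := mass_nonneg P S
    have hfin : revenueOn P θ Q m - 3 * w ≤ p * mass P S := by
      rw [revenueOn, ← hSeq]
      nlinarith
    linarith
  -- If `Q` is empty, all types are rare and their mass bounds the optimal revenue.
  · have hopt := optimalRevenue_le P hθ hQmem le_rfl
      (fun i hi => absurd ⟨i, hi⟩ hQ)
    have := mul_nonneg hp0 (mass_nonneg P S)
    linarith

end TypicalRun

/-! ### Expected revenue of one round -/

section ExpectedRevenue

variable {τ : Thresholds d} {T : ℕ} {η lam : ℝ} {θ : Fin d → ℝ}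
  (P : PMF (Fin d)) (D : Kernel (Fin d) unitInterval) [IsMarkovKernel D]

lemma measurableSet_mem_activeAfter (hτ : MeasurableThresholds τ) (t : ℕ) (j : Fin d) :
    MeasurableSet {x : ℕ → Review d | j ∈ activeAfter τ T η lam θ x t} := by
  have h : ObsMeasurable fun h : List (Obs d) => j ∈ activeTypes T θ lam (phaseOne d T lam) h :=
    fun c => measurable_of_countable_index
      (measurableSet_activeTypes_observe_eq T θ lam (phaseOne d T lam) c)
      (G := fun S _ => j ∈ S) fun S => measurable_const
  exact measurableSet_setOfPred.2 (h.comp_history hτ (obsMeasurable_onlinePricing T η θ lam) t)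

lemma price_nonneg (hθ0 : ∀ i, 0 ≤ θ i) (x : ℕ → Review d) (t : ℕ) :
    0 ≤ price τ (onlinePricing T η θ lam) x t := onlinePricing_nonneg hθ0 _

lemma price_le_one (hθ1 : ∀ i, θ i ≤ 1) (x : ℕ → Review d) (t : ℕ) :
    price τ (onlinePricing T η θ lam) x t ≤ 1 := onlinePricing_le_one hθ1 _

/-- The type of the next buyer is independent of the price and of the active types. -/
lemma integral_price_mul_active (hd : 1 ≤ d) (hθ0 : ∀ i, 0 ≤ θ i) (hθ1 : ∀ i, θ i ≤ 1)
    (hτ : MeasurableThresholds τ) (t : ℕ) :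
    ∫ x, price τ (onlinePricing T η θ lam) x (t + 1)
        * {i | i ∈ activeAfter τ T η lam θ x t}.indicator (fun _ => (1 : ℝ)) (x (t + 1)).1
        ∂(buyersLaw P D)
      = ∫ x, price τ (onlinePricing T η θ lam) x (t + 1) * mass P (activeAfter τ T η lam θ x t)
        ∂(buyersLaw P D) := by
  classical
  have : Nonempty (Review d) := ⟨(⟨0, hd⟩, 0)⟩
  -- Split by the type `j` of the next buyer: `F j` depends on the rounds up to `t`, `G j` on round
  -- `t + 1` alone.
  let F : Fin d → (ℕ → Review d) → ℝ := fun j =>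
    {x | j ∈ activeAfter τ T η lam θ x t}.indicator
      fun x => price τ (onlinePricing T η θ lam) x (t + 1)
  let G : Fin d → (ℕ → Review d) → ℝ := fun j x =>
    {r : Review d | r.1 = j}.indicator (fun _ => (1 : ℝ)) (x (t + 1))
  have hFm : ∀ j, Measurable (F j) := fun j =>
    (measurable_price hτ (obsMeasurable_onlinePricing T η θ lam) (t + 1)).indicator
      (measurableSet_mem_activeAfter hτ t j)
  have hGm : ∀ j, Measurable (G j) := fun j =>
    (measurable_const.indicator (measurableSet_fst_eq j)).comp (measurable_pi_apply (t + 1))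
  have hF01 : ∀ j x, |F j x| ≤ 1 := by
    intro j x
    simp only [F, Set.indicator_apply]
    split_ifs
    · rw [abs_of_nonneg (price_nonneg hθ0 x _)]
      exact price_le_one hθ1 x _
    · simp
  have hG01 : ∀ j x, |G j x| ≤ 1 := by
    intro j x
    simp only [G, Set.indicator_apply]
    split_ifs <;> simp
  have hFi : ∀ j, Integrable (F j) (buyersLaw P D) := fun j =>
    Integrable.of_bound (hFm j).aestronglyMeasurable 1 (Filter.Eventually.of_forall (hF01 j))
  have hFGi : ∀ j, Integrable (fun x => F j x * G j x) (buyersLaw P D) := fun j =>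
    Integrable.of_bound ((hFm j).mul (hGm j)).aestronglyMeasurable 1
      (Filter.Eventually.of_forall fun x => by
        rw [Real.norm_eq_abs, abs_mul]
        exact mul_le_one₀ (hF01 j x) (abs_nonneg _) (hG01 j x))
  have hind : ∀ j, IndepFun (F j) (G j) (buyersLaw P D) := by
    intro j
    refine indepFun_of_dependsOn (buyerLaw P D) (A := Finset.Icc 1 t) (B := {t + 1}) (hFm j)
      (hGm j) ?_ ?_ (by simp)
    · intro x y h
      have := dependsOn_history τ (onlinePricing T η θ lam) t h
      simp only [F, Set.indicator_apply, Set.mem_ofPred_eq, price, Nat.add_sub_cancel, activeAfter,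
        this]
    · intro x y h
      have : x (t + 1) = y (t + 1) := h (t + 1) (by simp)
      simp only [G, this]
  have hGint : ∀ j, ∫ x, G j x ∂(buyersLaw P D) = (P j).toReal := by
    intro j
    have hmp : MeasurePreserving (Function.eval (t + 1)) (buyersLaw P D) (buyerLaw P D) :=
      measurePreserving_eval_infinitePi (fun _ : ℕ => buyerLaw P D) (t + 1)
    have h := integral_map (μ := buyersLaw P D) hmp.measurable.aemeasurable
      (f := {r : Review d | r.1 = j}.indicator (fun _ => (1 : ℝ)))
      (measurable_const.indicator (measurableSet_fst_eq j)).aestronglyMeasurable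
    rw [hmp.map_eq, integral_indicator_const _ (measurableSet_fst_eq j),
      buyerLaw_real_fst_eq] at h
    simpa [G] using h.symm
  have e1 : ∀ x, price τ (onlinePricing T η θ lam) x (t + 1)
        * {i | i ∈ activeAfter τ T η lam θ x t}.indicator (fun _ => (1 : ℝ)) (x (t + 1)).1
      = ∑ j, F j x * G j x := by
    intro x
    rw [Finset.sum_eq_single (x (t + 1)).1]
    · simp [F, G, Set.indicator_apply]
    · intro j _ hj
      simp [G, Ne.symm hj]
    · simp
  have e2 : ∀ x, price τ (onlinePricing T η θ lam) x (t + 1)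
        * mass P (activeAfter τ T η lam θ x t) = ∑ j, F j x * (P j).toReal := by
    intro x
    rw [mass, Finset.mul_sum, ← Finset.sum_filter_add_sum_filter_not Finset.univ
      (fun j => j ∈ activeAfter τ T η lam θ x t)]
    have z : ∑ j with j ∉ activeAfter τ T η lam θ x t, F j x * (P j).toReal = 0 := by
      refine Finset.sum_eq_zero fun j hj => ?_
      have := (Finset.mem_filter.1 hj).2
      simp [F, this]
    rw [z, add_zero, Finset.filter_mem_eq_inter, Finset.univ_inter]
    refine Finset.sum_congr rfl fun j hj => ?_
    simp [F, hj]
  simp only [e1, e2]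
  rw [integral_finsetSum _ fun j _ => hFGi j,
    integral_finsetSum _ fun j _ => (hFi j).mul_const _]
  refine Finset.sum_congr rfl fun j _ => ?_
  rw [(hind j).integral_fun_mul_eq_mul_integral (hFm j).aestronglyMeasurable
    (hGm j).aestronglyMeasurable, hGint, integral_mul_const]

lemma integrable_price_mul_bought (hθ0 : ∀ i, 0 ≤ θ i) (hθ1 : ∀ i, θ i ≤ 1)
    (hτ : MeasurableThresholds τ) (t : ℕ) :
    Integrable (fun x => price τ (onlinePricing T η θ lam) x t
      * bought τ (onlinePricing T η θ lam) x t) (buyersLaw P D) := by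
  have hA := obsMeasurable_onlinePricing T η θ lam
  refine Integrable.of_bound
    ((measurable_price hτ hA t).mul (measurable_bought hτ hA t)).aestronglyMeasurable 1
    (Filter.Eventually.of_forall fun x => ?_)
  rw [Real.norm_eq_abs, abs_of_nonneg (mul_nonneg (price_nonneg hθ0 x _)
    (bought_nonneg _ _ _ _))]
  exact mul_le_one₀ (price_le_one hθ1 x _) (bought_nonneg _ _ _ _) (bought_le_one _ _ _ _)

/-- Counting only purchases by active types lowers the revenue, and independence turns their
indicator into their mass. The pathwise bound then applies off the atypical event, on which at most
`1` is lost. -/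
lemma expected_revenue_ge (hd : 1 ≤ d) (hθ : Monotone θ) (hθ0 : ∀ i, 0 ≤ θ i)
    (hθ1 : ∀ i, θ i ≤ 1) (hmean : ∀ i, ∫ v, (v : ℝ) ∂(D i) = θ i) (hη : 0 < η) (hη1 : η ≤ 1)
    (hτm : MeasurableThresholds τ) (hτ : Pessimistic η T τ)
    (hn : 32 * Real.log (d * (T : ℝ) ^ 2) ≤ lam * phaseOne d T lam) (hn0 : 0 < phaseOne d T lam)
    {q₀ : ℝ} (hq₀ : 0 < q₀) (hq : ∀ i, lam / 2 ≤ (P i).toReal → q₀ ≤ (P i).toReal) {t : ℕ}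
    (htn : phaseOne d T lam < t) (ht : t < T) :
    optimalRevenue P θ - (mass P (rareTypes P lam) + 4 * rho d T (t - phaseOne d T lam)
        + 3 * √(Real.log (d * T / η) / (t * q₀))) - 6 / T
      ≤ ∫ x, price τ (onlinePricing T η θ lam) x (t + 1)
        * bought τ (onlinePricing T η θ lam) x (t + 1) ∂(buyersLaw P D) := by
  classical
  set loss := mass P (rareTypes P lam) + 4 * rho d T (t - phaseOne d T lam)
        + 3 * √(Real.log (d * T / η) / (t * q₀)) with hloss
  have hloss0 : 0 ≤ loss := by
    have h1 := mass_nonneg P (rareTypes P lam)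
    have h2 : 0 ≤ rho d T (t - phaseOne d T lam) := Real.sqrt_nonneg _
    positivity
  have hA := obsMeasurable_onlinePricing T η θ lam
  -- A measurable hull has the same measure, so measurability of the typical event is not needed.
  set B := toMeasurable (buyersLaw P D) {x | ¬ Typical P θ lam (phaseOne d T lam) T x}
  have hB : MeasurableSet B := measurableSet_toMeasurable _ _
  have hBprob : (buyersLaw P D).real B ≤ 6 / T := by
    rw [measureReal_def, measure_toMeasurable, ← measureReal_def]
    exact not_typical_prob_le P D hmean hd (by omega) hn
  have hp0 : ∀ x, 0 ≤ price τ (onlinePricing T η θ lam) x (t + 1) := fun x =>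
    price_nonneg hθ0 x _
  have hp1 : ∀ x, price τ (onlinePricing T η θ lam) x (t + 1) ≤ 1 := fun x =>
    price_le_one hθ1 x _
  have hmassm : Measurable fun x : ℕ → Review d => mass P (activeAfter τ T η lam θ x t) := by
    have h : ObsMeasurable fun h : List (Obs d) =>
        mass P (activeTypes T θ lam (phaseOne d T lam) h) :=
      fun c => measurable_of_countable_index
        (measurableSet_activeTypes_observe_eq T θ lam (phaseOne d T lam) c)
        (G := fun S _ => mass P S) fun S => measurable_const
    exact h.comp_history hτm hA t
  have hint2 : Integrable (fun x => price τ (onlinePricing T η θ lam) x (t + 1)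
      * mass P (activeAfter τ T η lam θ x t)) (buyersLaw P D) := by
    refine Integrable.of_bound ((measurable_price hτm hA _).mul hmassm).aestronglyMeasurable 1
      (Filter.Eventually.of_forall fun x => ?_)
    rw [Real.norm_eq_abs, abs_of_nonneg (mul_nonneg (hp0 x) (mass_nonneg _ _))]
    exact mul_le_one₀ (hp1 x) (mass_nonneg _ _) (mass_le_one _ _)
  have hle1 : ∫ x, price τ (onlinePricing T η θ lam) x (t + 1)
        * {i | i ∈ activeAfter τ T η lam θ x t}.indicator (fun _ => (1 : ℝ)) (x (t + 1)).1
        ∂(buyersLaw P D)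
      ≤ ∫ x, price τ (onlinePricing T η θ lam) x (t + 1)
        * bought τ (onlinePricing T η θ lam) x (t + 1) ∂(buyersLaw P D) := by
    refine integral_mono_of_nonneg (Filter.Eventually.of_forall fun x => ?_)
      (integrable_price_mul_bought P D hθ0 hθ1 hτm _) (Filter.Eventually.of_forall fun x => ?_)
    · exact mul_nonneg (hp0 x) (Set.indicator_nonneg (fun _ _ => zero_le_one) _)
    · refine mul_le_mul_of_nonneg_left ?_ (hp0 x)
      by_cases h : (x (t + 1)).1 ∈ activeAfter τ T η lam θ x t
      · rw [bought_of_buys _ _ _ (buys_of_mem_active hη hτ ht htn.le h)]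
        simp [h]
      · simpa [Set.indicator_apply, h] using bought_nonneg _ _ _ _
  rw [integral_price_mul_active P D hd hθ0 hθ1 hτm t] at hle1
  refine le_trans ?_ hle1
  calc optimalRevenue P θ - loss - 6 / T
      ≤ ∫ x, ((optimalRevenue P θ - loss) - B.indicator (fun _ => (1 : ℝ)) x)
          ∂(buyersLaw P D) := by
        rw [integral_sub (integrable_const _) ((integrable_const _).indicator hB),
          integral_indicator_const _ hB]
        simp only [integral_const, smul_eq_mul, mul_one, probReal_univ, one_mul]
        linarith
    _ ≤ _ := by
        refine integral_mono ((integrable_const _).sub ((integrable_const _).indicator hB)) hint2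
          fun x => ?_
        change (optimalRevenue P θ - loss) - B.indicator (fun _ => (1 : ℝ)) x ≤ _
        by_cases hx : x ∈ B
        · rw [Set.indicator_of_mem hx]
          have h1 := optimalRevenue_le_one P θ
          have h2 := mul_nonneg (hp0 x) (mass_nonneg P (activeAfter τ T η lam θ x t))
          linarith
        · rw [Set.indicator_of_notMem hx, sub_zero]
          have hty : Typical P θ lam (phaseOne d T lam) T x := by
            by_contra h
            exact hx (subset_toMeasurable _ _ h)
          exact optimalRevenue_le_price_mul_mass hθ hθ0 hθ1 hη hη1 hτ hd hty hn0 hq₀ hq htn ht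

end ExpectedRevenue

/-! ### Sums of inverse square roots -/

section Sums

lemma sum_inv_sqrt_le (m : ℕ) : ∑ k ∈ Finset.Ico 1 (m + 1), 1 / √(k : ℝ) ≤ 2 * √(m : ℝ) := by
  induction m with
  | zero => simp
  | succ m ih =>
    rw [Finset.sum_Ico_succ_top (by omega)]
    have hb : 0 < √((m + 1 : ℕ) : ℝ) := Real.sqrt_pos.2 (by positivity)
    have ha2 : √(m : ℝ) ^ 2 = m := Real.sq_sqrt (by positivity)
    have hb2 : √((m + 1 : ℕ) : ℝ) ^ 2 = m + 1 := by
      rw [Real.sq_sqrt (by positivity)]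
      push_cast
      rfl
    -- The right-hand side telescopes.
    have h : 1 / √((m + 1 : ℕ) : ℝ) ≤ 2 * (√((m + 1 : ℕ) : ℝ) - √(m : ℝ)) := by
      rw [div_le_iff₀ hb]
      nlinarith [sq_nonneg (√((m + 1 : ℕ) : ℝ) - √(m : ℝ))]
    linarith

lemma sum_Ico_inv_sqrt_le (m : ℕ) : ∑ k ∈ Finset.Ico 1 m, 1 / √(k : ℝ) ≤ 2 * √(m : ℝ) :=
  (Finset.sum_le_sum_of_subset_of_nonneg (Finset.Ico_subset_Ico_right (Nat.le_succ m))
    fun _ _ _ => by positivity).trans (sum_inv_sqrt_le m)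

lemma sum_rho_le (d : ℕ) {n T : ℕ} (hnT : n ≤ T) :
    ∑ t ∈ Finset.Ico (n + 1) T, rho d T ((t : ℝ) - n)
      ≤ 2 * √(T * (Real.log (d * (T : ℝ) ^ 2) / 2)) := by
  have e : ∑ t ∈ Finset.Ico (n + 1) T, rho d T ((t : ℝ) - n)
      = ∑ k ∈ Finset.Ico 1 (T - n), rho d T (k : ℝ) := by
    have := Finset.sum_Ico_add' (fun t : ℕ => rho d T ((t : ℝ) - n)) 1 (T - n) n
    rw [Nat.sub_add_cancel hnT, add_comm 1 n] at this
    rw [← this]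
    refine Finset.sum_congr rfl fun k _ => ?_
    push_cast
    rw [add_sub_cancel_right]
  rw [e]
  set L := Real.log (d * (T : ℝ) ^ 2)
  have h1 : ∀ k : ℕ, rho d T (k : ℝ) = √(L / 2) * (1 / √(k : ℝ)) := by
    intro k
    rw [rho, mul_one_div, ← Real.sqrt_div' _ (Nat.cast_nonneg k), div_div]
  simp only [h1]
  rw [← Finset.mul_sum, Real.sqrt_mul (Nat.cast_nonneg T)]
  have h2 : √((T - n : ℕ) : ℝ) ≤ √(T : ℝ) := Real.sqrt_le_sqrt (by exact_mod_cast Nat.sub_le T n)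
  calc _ ≤ √(L / 2) * (2 * √(T : ℝ)) := by
        gcongr
        exact (sum_Ico_inv_sqrt_le _).trans (by gcongr)
    _ = _ := by ring

lemma sum_sqrt_div_le {c : ℝ} (hc : 0 ≤ c) (n T : ℕ) :
    ∑ t ∈ Finset.Ico (n + 1) T, √(c / t) ≤ 2 * √(T * c) := by
  have h1 : ∀ k : ℕ, √(c / k) = √c * (1 / √(k : ℝ)) := by
    intro k
    rw [mul_one_div, Real.sqrt_div hc]
  simp only [h1]
  rw [← Finset.mul_sum, Real.sqrt_mul (Nat.cast_nonneg T)]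
  calc _ ≤ √c * ∑ t ∈ Finset.Ico 1 T, 1 / √(t : ℝ) := by
        gcongr
        omega
    _ ≤ √c * (2 * √(T : ℝ)) := by
        gcongr
        exact sum_Ico_inv_sqrt_le T
    _ = _ := by ring

end Sums

/-! ### The regret bound for general `λ` -/

section Regret

variable {τ : Thresholds d} {T : ℕ} {η lam : ℝ} {θ : Fin d → ℝ}
  (P : PMF (Fin d)) (D : Kernel (Fin d) unitInterval) [IsMarkovKernel D]

lemma le_phaseOne (hlam : 0 < lam) :
    32 * Real.log (d * (T : ℝ) ^ 2) ≤ lam * phaseOne d T lam := by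
  have h := (Nat.lt_floor_add_one (32 * Real.log (d * (T : ℝ) ^ 2) / lam + 1)).le
  rw [add_le_add_iff_right, div_le_iff₀ hlam] at h
  rw [mul_comm lam]
  exact h

lemma log_nonneg_of_one_le (hd : 1 ≤ d) (hT : 1 ≤ T) : 0 ≤ Real.log (d * (T : ℝ) ^ 2) := by
  have hd' : (1 : ℝ) ≤ d := by exact_mod_cast hd
  have hT' : (1 : ℝ) ≤ T := by exact_mod_cast hT
  exact Real.log_nonneg (by nlinarith)

lemma phaseOne_le (hd : 1 ≤ d) (hT : 1 ≤ T) (hlam : 0 < lam) :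
    (phaseOne d T lam : ℝ) ≤ 32 * Real.log (d * (T : ℝ) ^ 2) / lam + 1 := by
  have := log_nonneg_of_one_le hd hT
  exact Nat.floor_le (by positivity)

lemma phaseOne_pos (hd : 1 ≤ d) (hT : 1 ≤ T) (hlam : 0 < lam) : 0 < phaseOne d T lam := by
  have := log_nonneg_of_one_le hd hT
  exact Nat.floor_pos.2 (le_add_of_nonneg_left (by positivity))

/-- The regret bound for an arbitrary parameter `lam`, where `q₀` bounds the probabilities of the
types that may be common from below. -/
lemma expectedRegret_le (hd : 1 ≤ d) (hT : 1 ≤ T) (hθ : Monotone θ)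
    (hmean : ∀ i, ∫ v, (v : ℝ) ∂(D i) = θ i) (hη : 0 < η) (hη1 : η ≤ 1)
    (hτm : MeasurableThresholds τ) (hτ : Pessimistic η T τ) (hlam : 0 < lam)
    {q₀ : ℝ} (hq₀ : 0 < q₀) (hq : ∀ i, lam / 2 ≤ (P i).toReal → q₀ ≤ (P i).toReal) :
    expectedRegret T P D θ τ (onlinePricing T η θ lam) ≤
      32 * Real.log (d * (T : ℝ) ^ 2) / lam + 8 + T * mass P (rareTypes P lam)
        + 8 * √(T * (Real.log (d * (T : ℝ) ^ 2) / 2))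
        + 6 * √(T / q₀ * Real.log (d * T / η)) := by
  have hθ0 : ∀ i, 0 ≤ θ i := fun i => by
    rw [← hmean i]
    exact integral_nonneg fun v => v.2.1
  have hθ1 : ∀ i, θ i ≤ 1 := fun i => by
    rw [← hmean i]
    calc ∫ v, (v : ℝ) ∂(D i) ≤ ∫ _, (1 : ℝ) ∂(D i) :=
          integral_mono_of_nonneg (Filter.Eventually.of_forall fun v => v.2.1)
            (integrable_const _) (Filter.Eventually.of_forall fun v => v.2.2)
      _ = 1 := by simp
  have hT' : (1 : ℝ) ≤ T := by exact_mod_cast hT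
  have hd' : (1 : ℝ) ≤ d := by exact_mod_cast hd
  set n := phaseOne d T lam with hndef
  have hn := le_phaseOne (d := d) (T := T) hlam
  have hn0 := phaseOne_pos hd hT hlam
  have hnle := phaseOne_le hd hT hlam
  set R : ℕ → ℝ := fun t => ∫ x, price τ (onlinePricing T η θ lam) x t
    * bought τ (onlinePricing T η θ lam) x t ∂(buyersLaw P D) with hR
  have hR0 : ∀ t, 0 ≤ R t := fun t =>
    integral_nonneg fun x => mul_nonneg (price_nonneg hθ0 x _) (bought_nonneg _ _ _ _)
  have hreg : expectedRegret T P D θ τ (onlinePricing T η θ lam)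
      = T * optimalRevenue P θ - ∑ t ∈ Finset.Icc 1 T, R t := by
    rw [expectedRegret, integral_finsetSum _ fun t _ =>
      integrable_price_mul_bought P D hθ0 hθ1 hτm t]
  have hopt := optimalRevenue_le_one P θ
  have hmass0 := mass_nonneg P (rareTypes P lam)
  have hΛ : 0 ≤ Real.log (d * T / η) := by
    refine Real.log_nonneg ?_
    rw [le_div_iff₀ hη]
    nlinarith
  have hsq1 := Real.sqrt_nonneg (T * (Real.log (d * (T : ℝ) ^ 2) / 2))
  have hsq2 := Real.sqrt_nonneg (T / q₀ * Real.log (d * T / η))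
  have hTm : 0 ≤ T * mass P (rareTypes P lam) := by positivity
  rw [hreg]
  by_cases hnT : T ≤ n
  · have h1 : 0 ≤ ∑ t ∈ Finset.Icc 1 T, R t := Finset.sum_nonneg fun t _ => hR0 t
    have h2 : (T : ℝ) ≤ n := by exact_mod_cast hnT
    nlinarith
  · have hnT := not_le.1 hnT
    -- The first `n + 1` rounds are given up, at a cost of at most `1` each. The constant `8`
    -- collects round `n + 1`, the `1` in the bound on `n`, and `6` for the atypical event.
    have hsum : ∑ t ∈ Finset.Ico (n + 1) T, R (t + 1) ≤ ∑ t ∈ Finset.Icc 1 T, R t := by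
      rw [Finset.sum_Ico_add' R (n + 1) T 1]
      refine Finset.sum_le_sum_of_subset_of_nonneg (fun t ht => ?_) fun t _ _ => hR0 t
      rw [Finset.mem_Ico] at ht
      rw [Finset.mem_Icc]
      omega
    have hterm : ∀ t ∈ Finset.Ico (n + 1) T,
        optimalRevenue P θ - (mass P (rareTypes P lam) + 4 * rho d T (t - n)
        + 3 * √(Real.log (d * T / η) / q₀ / t)) - 6 / T ≤ R (t + 1) := by
      intro t ht
      rw [Finset.mem_Ico] at ht
      rw [div_div, mul_comm q₀]
      exact expected_revenue_ge P D hd hθ hθ0 hθ1 hmean hη hη1 hτm hτ hn hn0 hq₀ hq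
        (by omega) ht.2
    have h1 := (Finset.sum_le_sum hterm).trans hsum
    simp only [Finset.sum_sub_distrib, Finset.sum_add_distrib, Finset.sum_const, nsmul_eq_mul,
      ← Finset.mul_sum, Nat.card_Ico] at h1
    have hcard : ((T - (n + 1) : ℕ) : ℝ) = T - n - 1 := by
      rw [Nat.cast_sub hnT]
      push_cast
      ring
    rw [hcard] at h1
    have h2 := sum_rho_le d hnT.le
    have h3 := sum_sqrt_div_le (div_nonneg hΛ hq₀.le) n T
    have h4 : (T : ℝ) * (Real.log (d * T / η) / q₀) = T / q₀ * Real.log (d * T / η) := by ring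
    rw [h4] at h3
    have h5 : ((T : ℝ) - n - 1) * (6 / T) ≤ 6 := by
      rw [mul_div_assoc', div_le_iff₀ (by positivity)]
      have : (0 : ℝ) ≤ n := Nat.cast_nonneg n
      linarith
    have h6 : ((n : ℝ) + 1) * optimalRevenue P θ ≤ n + 1 :=
      mul_le_of_le_one_right (by positivity) hopt
    have h7 : ((T : ℝ) - n - 1) * mass P (rareTypes P lam) ≤ T * mass P (rareTypes P lam) := by
      refine mul_le_mul_of_nonneg_right ?_ hmass0
      have : (0 : ℝ) ≤ n := Nat.cast_nonneg n
      linarith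
    linarith

lemma mass_rareTypes_le (hlam : 0 ≤ lam) : mass P (rareTypes P lam) ≤ d * lam := by
  calc mass P (rareTypes P lam) ≤ ∑ _j ∈ rareTypes P lam, lam :=
        Finset.sum_le_sum fun j hj => (Finset.mem_filter.1 hj).2.le
    _ = (rareTypes P lam).card * lam := by simp
    _ ≤ d * lam := by
        gcongr
        simpa using Finset.card_le_univ (rareTypes P lam)

lemma qmin_le (i : Fin d) : qmin P ≤ (P i).toReal :=
  ciInf_le (Set.finite_range _).bddBelow i

end Regret

end ReviewPricing

end

theorem corollary1 :
    ∃ C : ℝ, 0 < C ∧ ∀ (d T : ℕ) (η lam : ℝ) (P : PMF (Fin d)) (D : Kernel (Fin d) unitInterval)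
      [IsMarkovKernel D] (θ : Fin d → ℝ) (τ : ReviewPricing.Thresholds d),
      1 ≤ T → 0 < η → η ≤ 1 →
      Monotone θ → (∀ i, ∫ v, (v : ℝ) ∂(D i) = θ i) →
      ReviewPricing.MeasurableThresholds τ → ReviewPricing.Pessimistic η T τ →
      lam = (d : ℝ) ^ (-(2 / 3) : ℝ) * (T : ℝ) ^ (-(1 / 3) : ℝ) →
      (ReviewPricing.qmin P ≤ 2 * lam →
        ReviewPricing.expectedRegret T P D θ τ (ReviewPricing.onlinePricing T η θ lam) ≤
          C * ((T : ℝ) ^ (2 / 3 : ℝ) * (d : ℝ) ^ (1 / 3 : ℝ)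
            + (T : ℝ) ^ (2 / 3 : ℝ) * (d : ℝ) ^ (1 / 3 : ℝ) * √(Real.log (d * T / η))
            + √(T * Real.log (d * T))
            + (T : ℝ) ^ (1 / 3 : ℝ) * (d : ℝ) ^ (2 / 3 : ℝ) * Real.log (d * T))) ∧
      (2 * lam < ReviewPricing.qmin P →
        ReviewPricing.expectedRegret T P D θ τ (ReviewPricing.onlinePricing T η θ lam) ≤
          C * (√(T / ReviewPricing.qmin P * Real.log (d * T / η))
            + (T : ℝ) ^ (1 / 3 : ℝ) * (d : ℝ) ^ (2 / 3 : ℝ) * Real.log (d * T))) := by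
  -- `64` for the first phase, as `log (dT²) ≤ 2 log (dT)`, and `8` for the additive constant.
  refine ⟨72, by norm_num, ?_⟩
  intro d T η lam P D _ θ τ hT hη hη1 hθ hmean hτm hτ hlam
  have hd : 1 ≤ d := by
    obtain ⟨i, _⟩ := P.support_nonempty
    exact i.pos
  have hT' : (1 : ℝ) ≤ T := by exact_mod_cast hT
  have hd' : (1 : ℝ) ≤ d := by exact_mod_cast hd
  have hT0 : (0 : ℝ) < T := by linarith
  have hd0 : (0 : ℝ) < d := by linarith
  have hlam0 : 0 < lam := by rw [hlam]; positivity
  set D' : ℝ := (T : ℝ) ^ (1 / 3 : ℝ) * (d : ℝ) ^ (2 / 3 : ℝ) with hD'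
  set X : ℝ := (T : ℝ) ^ (2 / 3 : ℝ) * (d : ℝ) ^ (1 / 3 : ℝ) with hX
  have hinv : lam * D' = 1 := by
    rw [hlam, hD', Real.rpow_neg hd0.le, Real.rpow_neg hT0.le]
    field_simp
  have hX1 : 1 ≤ X := by
    have h1 := Real.one_le_rpow hT' (by norm_num : (0 : ℝ) ≤ 2 / 3)
    have h2 := Real.one_le_rpow hd' (by norm_num : (0 : ℝ) ≤ 1 / 3)
    nlinarith
  -- The choice of `λ` balances the rare types, which cost `T d λ`, with the learning of values,
  -- which costs about `√(T/λ)`: both equal `X`. The first phase costs about `1/λ = D'`, up to the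
  -- logarithm.
  have hTd : T * (d * lam) = X := by
    have e1 : (T : ℝ) = (T : ℝ) ^ (2 / 3 : ℝ) * (T : ℝ) ^ (1 / 3 : ℝ) := by
      rw [← Real.rpow_add hT0]; norm_num
    have e2 : (d : ℝ) = (d : ℝ) ^ (1 / 3 : ℝ) * (d : ℝ) ^ (2 / 3 : ℝ) := by
      rw [← Real.rpow_add hd0]; norm_num
    calc T * (d * lam) = X * (lam * D') := by
          rw [hX, hD']
          nth_rewrite 1 [e1]
          nth_rewrite 1 [e2]
          ring
      _ = X := by rw [hinv, mul_one]
  have hX2 : (T : ℝ) / lam = X ^ 2 := by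
    rw [div_eq_iff hlam0.ne']
    have e : X * X = T * D' := by
      rw [hX, hD']
      have e1 : (T : ℝ) ^ (2 / 3 : ℝ) * (T : ℝ) ^ (2 / 3 : ℝ) = T * (T : ℝ) ^ (1 / 3 : ℝ) := by
        rw [← Real.rpow_add hT0, ← Real.rpow_one_add' hT0.le (by norm_num)]
        norm_num
      have e2 : (d : ℝ) ^ (1 / 3 : ℝ) * (d : ℝ) ^ (1 / 3 : ℝ) = (d : ℝ) ^ (2 / 3 : ℝ) := by
        rw [← Real.rpow_add hd0]
        norm_num
      linear_combination (d : ℝ) ^ (1 / 3 : ℝ) * (d : ℝ) ^ (1 / 3 : ℝ) * e1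
        + T * (T : ℝ) ^ (1 / 3 : ℝ) * e2
    calc (T : ℝ) = T * (lam * D') := by rw [hinv, mul_one]
      _ = X ^ 2 * lam := by rw [sq, e]; ring
  set ℓ := Real.log (d * T) with hℓ
  have hdT : (1 : ℝ) ≤ d * T := by nlinarith
  have hℓ0 : 0 ≤ ℓ := Real.log_nonneg hdT
  have hL : Real.log (d * (T : ℝ) ^ 2) ≤ 2 * ℓ := by
    have e : 2 * ℓ = Real.log ((d * T : ℝ) ^ 2) := by
      rw [Real.log_pow]
      norm_num [hℓ]
    rw [e, mul_pow]
    refine Real.log_le_log (by positivity) ?_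
    gcongr
    exact le_self_pow₀ hd' (by norm_num)
  have hphase : 32 * Real.log (d * (T : ℝ) ^ 2) / lam ≤ 64 * (D' * ℓ) := by
    rw [div_le_iff₀ hlam0]
    calc 32 * Real.log (d * (T : ℝ) ^ 2) ≤ 64 * ℓ * (lam * D') := by rw [hinv]; linarith
      _ = _ := by ring
  have hest : √(T * (Real.log (d * (T : ℝ) ^ 2) / 2)) ≤ √(T * ℓ) := by
    gcongr
    linarith
  set Λ := Real.log (d * T / η) with hΛ
  have hℓΛ : ℓ ≤ Λ := by
    refine Real.log_le_log (by positivity) ?_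
    rw [le_div_iff₀ hη]
    nlinarith
  have hD0 : 0 < D' := by positivity
  have hs1 := Real.sqrt_nonneg (T * ℓ)
  have hDℓ : 0 ≤ D' * ℓ := by positivity
  constructor
  · intro _
    -- Here `q₀ = λ/2`, the least probability a type of `Q` can have on a typical sequence.
    have h := ReviewPricing.expectedRegret_le P D hd hT hθ hmean hη hη1 hτm hτ hlam0
      (half_pos hlam0) (fun _ hi => hi)
    have hm := mul_le_mul_of_nonneg_left (ReviewPricing.mass_rareTypes_le P hlam0.le) hT0.le
    rw [hTd] at hm
    have hw : √(T / (lam / 2) * Λ) ≤ 2 * (X * √Λ) := by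
      have e : T / (lam / 2) * Λ = 2 * (X ^ 2 * Λ) := by rw [← hX2]; field_simp
      rw [e]
      refine Real.sqrt_le_iff.2 ⟨by positivity, ?_⟩
      have h0 : 0 ≤ X ^ 2 * Λ := mul_nonneg (sq_nonneg X) (hℓ0.trans hℓΛ)
      have e2 : (2 * (X * √Λ)) ^ 2 = 4 * (X ^ 2 * √Λ ^ 2) := by ring
      rw [e2, Real.sq_sqrt (hℓ0.trans hℓΛ)]
      linarith
    have hXΛ : 0 ≤ X * √Λ := by positivity
    linarith
  · intro hqlam
    set q := ReviewPricing.qmin P with hq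
    have hq0 : 0 < q := by linarith
    -- Here `q₀` is the smallest probability of all, and no type is rare.
    have h := ReviewPricing.expectedRegret_le P D hd hT hθ hmean hη hη1 hτm hτ hlam0
      hq0 (fun i _ => ReviewPricing.qmin_le P i)
    have hrare : ReviewPricing.rareTypes P lam = ∅ := by
      refine Finset.filter_eq_empty_iff.2 fun i _ => ?_
      have := ReviewPricing.qmin_le P i
      linarith
    rw [hrare, ReviewPricing.mass, Finset.sum_empty, mul_zero, add_zero] at h
    have hq1 : q ≤ 1 := by
      refine (ReviewPricing.qmin_le P ⟨0, hd⟩).trans ?_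
      exact ENNReal.toReal_le_of_le_ofReal zero_le_one (by simpa using P.coe_le_one _)
    have hw : √(T * ℓ) ≤ √(T / q * Λ) := by
      gcongr
      rw [le_div_iff₀ hq0]
      nlinarith
    -- No term `X` is available to absorb the constant `8`, so `D' ℓ ≥ 1` is needed. From `2λ < q ≤
    -- 1` follows `dT ≥ D' = 1/λ > 2`; being an integer, `dT` is at least `3 > e`, so `ℓ ≥ 1`.
    have hD2 : 2 < D' := by
      by_contra hc
      nlinarith [not_lt.1 hc]
    have hDdT : D' ≤ d * T := by
      rw [hD', mul_comm]
      gcongr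
      · exact Real.rpow_le_self_of_one_le hd' (by norm_num)
      · exact Real.rpow_le_self_of_one_le hT' (by norm_num)
    have hdT3 : (3 : ℝ) ≤ d * T := by
      have h2 : (2 : ℝ) < d * T := hD2.trans_le hDdT
      have h3 : 2 < d * T := by exact_mod_cast h2
      exact_mod_cast h3
    have hℓ1 : 1 ≤ ℓ := by
      rw [hℓ, Real.le_log_iff_exp_le (by positivity)]
      linarith [Real.exp_one_lt_d9]
    have hs2 := Real.sqrt_nonneg (T / q * Λ)
    nlinarith
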